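/- **Language.** The types of probabilistic PCF are $\sigma,\tau ::= \mathsf{nat}\mid \sigma\Rightarrow\tau$, and its terms are $$M,N,\dots ::= \underline n \mid x \mid \mathsf{succ}(M) \mid \mathsf{if}(M,P,z\cdot R)\mid \lambda x^\sigma M\mid (M)N\mid \mathsf{coin}(p)\mid \mathsf{fix}(M)$$ with $n\in\mathbb N$ and $p\in[0,1]\cap\mathbb Q$, taken up to renaming of bound variables. Typing is the usual one: $\underline n$ and $\mathsf{coin}(p)$ have type $\mathsf{nat}$; $\mathsf{succ}(M):\mathsf{nat}$ if $M:\mathsf{nat}$; $\Gamma\vdash\mathsf{if}(M,P,z\cdot R):\sigma$ if $\Gamma\vdash M:\mathsf{nat}$, $\Gamma\vdash P:\sigma$ and $\Gamma,z:\mathsf{nat}\vdash R:\sigma$; $\mathsf{fix}(M):\sigma$ if $M:\sigma\Rightarrow\sigma$; and the simply typed rules for variables, abstraction and application. **Weak reduction.** $M\to_p M'$ ($M$ reduces to $M'$ in one step with probability $p$) is generated by the rules $(\lambda x^\sigma M)N\to_1 M[N/x]$, $\mathsf{fix}(M)\to_1 (M)\mathsf{fix}(M)$, $\mathsf{succ}(\underline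 n)\to_1\underline{n+1}$, $\mathsf{if}(\underline 0,P,z\cdot R)\to_1 P$, $\mathsf{if}(\underline{n+1},P,z\cdot R)\to_1 R[\underline n/z]$, $\mathsf{coin}(p)\to_p\underline 0$, $\mathsf{coin}(p)\to_{1-p}\underline 1$, and if $M\to_p M'$ then $(M)N\to_p(M')N$, $\mathsf{succ}(M)\to_p\mathsf{succ}(M')$ and $\mathsf{if}(M,P,z\cdot R)\to_p\mathsf{if}(M',P,z\cdot R)$. A term is weak-normal if no reduction is possible from it. Let $S$ be the stochastic matrix indexed by the closed terms of type $\mathsf{nat}$ with $S_{M,M'}=p$ if $M\to_pM'$, $S_{M,M'}=1$ if $M$ is weak-normal and $M'=M$, and $S_{M,M'}=0$ otherwise. Let $S^\infty_{M,M'}=\sup_{k\in\mathbb N}(S^k)_{M,M'}$ if $S_{M',M'}=1$, and $S^\infty_{M,M'}=0$ otherwise; for $M'$ weak-normal, this is the probability that $M$ reduces to $M'$ in finitely many steps. **Model.** For a countable set $I$ and $u,u'\in(\mathbb R_{\ge0})^I$ let $\langle u,u'\rangle=\sum_{i\in I}u_iu'_i\in[0,\infty]$, and for $\mathcal X\subseteq(\mathbb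 R_{\ge0})^I$ let $\mathcal X^\perp=\{u'\mid\forall u\in\mathcal X\ \langle u,u'\rangle\le1\}$. A probabilistic coherence space is a pair $X=(|X|,\mathsf PX)$ with $|X|$ countable and $\mathsf PX\subseteq(\mathbb R_{\ge0})^{|X|}$ such that $\mathsf PX^{\perp\perp}=\mathsf PX$ and, for each $a\in|X|$, some $u\in\mathsf PX$ has $u_a>0$ and the set $\{u_a\mid u\in\mathsf PX\}$ is bounded. The space $\mathsf N$ has web $\mathbb N$ and $\mathsf P\mathsf N=\{u\mid\sum_nu_n\le1\}$; we write $e_n\in\mathsf P\mathsf N$ for the family with $(e_n)_k=\delta_{n,k}$. The web of $X\mathbin\&Y$ is $|X|\sqcup|Y|$, with $\mathsf P(X\mathbin\&Y)=\mathsf PX\times\mathsf PY$, and $\top$ has an empty web. The web of $X\multimap Y$ is $|X|\times|Y|$, and $t\in\mathsf P(X\multimap Y)$ iff $t\,u:=(\sum_at_{a,b}u_a)_b\in\mathsf PY$ for all $u\in\mathsf PX$. The web of $!X$ is the set of finite multisets of elements of $|X|$, and $\mathsf P(!X)=\{u^!\mid u\in\mathsf PX\}^{\perp\perp}$, where $(u^!)_\mu=u^\mu=\prod_au_a^{\mu(a)}$.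 Finally $X\Rightarrow Y$ is $!X\multimap Y$, and the morphisms from $X$ to $Y$ in the Kleisli category of $!$ are the elements of $\mathsf P(X\Rightarrow Y)$; such an $s$ is determined by the function $\hat s:\mathsf PX\to\mathsf PY$, $\hat s(u)=s\,u^!$. Types are interpreted by $[\mathsf{nat}]=\mathsf N$ and $[\sigma\Rightarrow\tau]=[\sigma]\Rightarrow[\tau]$, a context $\Gamma=(x_1:\sigma_1,\dots,x_k:\sigma_k)$ by $[\Gamma]=[\sigma_1]\mathbin\&\cdots\mathbin\&[\sigma_k]$ (by $\top$ if $k=0$), and a term $\Gamma\vdash M:\sigma$ by the Kleisli morphism $[M]_\Gamma$ from $[\Gamma]$ to $[\sigma]$ whose function, still written $[M]_\Gamma$, is given by induction on $M$ as follows, for $\vec u\in\mathsf P[\Gamma]$ (elements of $\mathsf P[\sigma\Rightarrow\tau]$ being also identified with their functions): - $[x_i]_\Gamma(\vec u)=u_i$, $[\underline n]_\Gamma(\vec u)=e_n$, $[\mathsf{coin}(p)]_\Gamma(\vec u)=p\,e_0+(1-p)e_1$, $[\mathsf{succ}(P)]_\Gamma(\vec u)=\sum_n[P]_\Gamma(\vec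 u)_n\,e_{n+1}$; - $[\mathsf{if}(P,Q,z\cdot R)]_\Gamma(\vec u)=[P]_\Gamma(\vec u)_0\,[Q]_\Gamma(\vec u)+\sum_n[P]_\Gamma(\vec u)_{n+1}\,[R]_{\Gamma,z:\mathsf{nat}}(\vec u,e_n)$; - $[(P)Q]_\Gamma(\vec u)=[P]_\Gamma(\vec u)([Q]_\Gamma(\vec u))$, $[\lambda x^\sigma P]_\Gamma(\vec u)(v)=[P]_{\Gamma,x:\sigma}(\vec u,v)$; - $[\mathsf{fix}(P)]_\Gamma(\vec u)=\sup_nf^n(0)$ where $f=[P]_\Gamma(\vec u)$. For a closed term $M$ of type $\mathsf{nat}$, the web of $!\top\multimap\mathsf N$ is identified with $\mathbb N$, so that $[M]$ is an element of $\mathsf P\mathsf N$. **Theorem.** Let $M$ be a closed term of probabilistic PCF with $\vdash M:\mathsf{nat}$. Then for all $n\in\mathbb N$ $$S^\infty_{M,\underline n}=[M]_n ,$$ that is, the probability that $M$ weak-reduces to the numeral $\underline n$ is the $n$-th coefficient of the interpretation of $M$ in probabilistic coherence spaces. -/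

import Mathlib

open scoped ENNReal

namespace PPCF

/-! ## Syntax -/

/-- Types: the ground type of natural numbers, and function types. -/
inductive Ty : Type
  | nat : Ty
  | imp : Ty → Ty → Ty

/-- Typing contexts; the most recently declared variable comes first. -/
abbrev Ctx : Type := List Ty

/-- `Var Γ σ` : the variables declared with type `σ` in `Γ` (typed de Bruijn indices). -/
inductive Var : Ctx → Ty → Type
  | zero {Γ : Ctx} {σ : Ty} : Var (σ :: Γ) σ
  | suc {Γ : Ctx} {σ τ : Ty} : Var Γ σ → Var (τ :: Γ) σ

/-- `Term Γ σ` : the terms `M` such that `Γ ⊢ M : σ`, up to renaming of bound variables.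
There is one constructor for each typing rule. In `ifz M P R`, the term `R` has one more
variable, of type `nat`. -/
inductive Term : Ctx → Ty → Type
  | num {Γ : Ctx} (n : ℕ) : Term Γ Ty.nat
  | var {Γ : Ctx} {σ : Ty} (x : Var Γ σ) : Term Γ σ
  | succ {Γ : Ctx} (M : Term Γ Ty.nat) : Term Γ Ty.nat
  | ifz {Γ : Ctx} {σ : Ty} (M : Term Γ Ty.nat) (P : Term Γ σ)
      (R : Term (Ty.nat :: Γ) σ) : Term Γ σ
  | lam {Γ : Ctx} {σ τ : Ty} (M : Term (σ :: Γ) τ) : Term Γ (Ty.imp σ τ)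
  | app {Γ : Ctx} {σ τ : Ty} (M : Term Γ (Ty.imp σ τ)) (N : Term Γ σ) : Term Γ τ
  | coin {Γ : Ctx} (p : Set.Icc (0 : ℚ) 1) : Term Γ Ty.nat
  | fix {Γ : Ctx} {σ : Ty} (M : Term Γ (Ty.imp σ σ)) : Term Γ σ

/-- Extension of a renaming under a binder. -/
def liftRen {Γ Δ : Ctx} {σ : Ty} (r : ∀ τ : Ty, Var Γ τ → Var Δ τ) :
    ∀ τ : Ty, Var (σ :: Γ) τ → Var (σ :: Δ) τ
  | _, Var.zero => Var.zero
  | _, Var.suc x => Var.suc (r _ x)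

/-- Renaming of the free variables of a term. -/
def Term.rename {Γ : Ctx} {σ : Ty} (M : Term Γ σ) :
    ∀ {Δ : Ctx}, (∀ τ : Ty, Var Γ τ → Var Δ τ) → Term Δ σ :=
  match M with
  | .num n => fun _ => .num n
  | .var x => fun r => .var (r _ x)
  | .succ M => fun r => .succ (M.rename r)
  | .ifz M P R => fun r => .ifz (M.rename r) (P.rename r) (R.rename (liftRen r))
  | .lam M => fun r => .lam (M.rename (liftRen r))
  | .app M N => fun r => .app (M.rename r) (N.rename r)
  | .coin p => fun _ => .coin p
  | .fix M => fun r => .fix (M.rename r)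

/-- Extension of a substitution under a binder. -/
def liftSub {Γ Δ : Ctx} {σ : Ty} (s : ∀ τ : Ty, Var Γ τ → Term Δ τ) :
    ∀ τ : Ty, Var (σ :: Γ) τ → Term (σ :: Δ) τ
  | _, Var.zero => .var Var.zero
  | _, Var.suc x => (s _ x).rename (fun _ => Var.suc)

/-- Simultaneous capture-avoiding substitution. -/
def Term.subst {Γ : Ctx} {σ : Ty} (M : Term Γ σ) :
    ∀ {Δ : Ctx}, (∀ τ : Ty, Var Γ τ → Term Δ τ) → Term Δ σ :=
  match M with
  | .num n => fun _ => .num n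
  | .var x => fun s => s _ x
  | .succ M => fun s => .succ (M.subst s)
  | .ifz M P R => fun s => .ifz (M.subst s) (P.subst s) (R.subst (liftSub s))
  | .lam M => fun s => .lam (M.subst (liftSub s))
  | .app M N => fun s => .app (M.subst s) (N.subst s)
  | .coin p => fun _ => .coin p
  | .fix M => fun s => .fix (M.subst s)

/-- The substitution that replaces the last declared variable by `N`. -/
def singleSub {Γ : Ctx} {σ : Ty} (N : Term Γ σ) : ∀ τ : Ty, Var (σ :: Γ) τ → Term Γ τ
  | _, Var.zero => N
  | _, Var.suc x => .var x

/-- `M[N/x]`, where `x` is the last variable declared in the context of `M`. -/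
def Term.inst {Γ : Ctx} {σ τ : Ty} (M : Term (σ :: Γ) τ) (N : Term Γ σ) : Term Γ τ :=
  M.subst (singleSub N)

/-! ## Weak reduction and its stochastic matrix -/

/-- Deterministic one-step reduction. -/
inductive DRed : {Γ : Ctx} → {σ : Ty} → Term Γ σ → Term Γ σ → Prop
  | beta {Γ : Ctx} {σ τ : Ty} (M : Term (σ :: Γ) τ) (N : Term Γ σ) :
      DRed (.app (.lam M) N) (M.inst N)
  | fix {Γ : Ctx} {σ : Ty} (M : Term Γ (Ty.imp σ σ)) : DRed (.fix M) (.app M (.fix M))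
  | succ {Γ : Ctx} (n : ℕ) : DRed (.succ (.num n) : Term Γ Ty.nat) (.num (n + 1))
  | ifzZero {Γ : Ctx} {σ : Ty} (P : Term Γ σ) (R : Term (Ty.nat :: Γ) σ) :
      DRed (.ifz (.num 0) P R) P
  | ifzSucc {Γ : Ctx} {σ : Ty} (n : ℕ) (P : Term Γ σ) (R : Term (Ty.nat :: Γ) σ) :
      DRed (.ifz (.num (n + 1)) P R) (R.inst (.num n))

/-- `Red M p M'` : the term `M` weak-reduces in one step to `M'` with probability `p`. -/
inductive Red : {Γ : Ctx} → {σ : Ty} → Term Γ σ → ℝ → Term Γ σ → Prop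
  | det {Γ : Ctx} {σ : Ty} {M M' : Term Γ σ} (h : DRed M M') : Red M 1 M'
  | coinZero {Γ : Ctx} (p : Set.Icc (0 : ℚ) 1) :
      Red (.coin p : Term Γ Ty.nat) ((p : ℚ) : ℝ) (.num 0)
  | coinOne {Γ : Ctx} (p : Set.Icc (0 : ℚ) 1) :
      Red (.coin p : Term Γ Ty.nat) (1 - ((p : ℚ) : ℝ)) (.num 1)
  | app {Γ : Ctx} {σ τ : Ty} {M M' : Term Γ (Ty.imp σ τ)} {p : ℝ} (N : Term Γ σ)
      (h : Red M p M') : Red (.app M N) p (.app M' N)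
  | succ {Γ : Ctx} {M M' : Term Γ Ty.nat} {p : ℝ} (h : Red M p M') :
      Red (.succ M) p (.succ M')
  | ifz {Γ : Ctx} {σ : Ty} {M M' : Term Γ Ty.nat} {p : ℝ} (P : Term Γ σ)
      (R : Term (Ty.nat :: Γ) σ) (h : Red M p M') : Red (.ifz M P R) p (.ifz M' P R)

/-- `M` is weak-normal: no reduction is possible from `M`. -/
def WeakNormal {Γ : Ctx} {σ : Ty} (M : Term Γ σ) : Prop :=
  ∀ (p : ℝ) (M' : Term Γ σ), ¬ Red M p M'

open Classical in
/-- The stochastic matrix of weak reduction on the terms of type `σ` in context `Γ`: the entry at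
`M, M'` is `p` if `M` reduces to `M'` with probability `p` (there is at most one such `p`), it is
`1` if `M` is weak-normal and `M' = M`, and it is `0` otherwise. -/
noncomputable def redMatrix (Γ : Ctx) (σ : Ty) (M M' : Term Γ σ) : ℝ≥0∞ :=
  if h : ∃ p : ℝ, Red M p M' then ENNReal.ofReal h.choose
  else if WeakNormal M ∧ M' = M then 1
  else 0

open Classical in
/-- Powers of a square matrix with non-negative coefficients, indexed by an arbitrary set. -/
noncomputable def matPow {I : Type} (S : I → I → ℝ≥0∞) : ℕ → I → I → ℝ≥0∞
  | 0 => fun i j => if i = j then 1 else 0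
  | n + 1 => fun i j => ∑' k : I, matPow S n i k * S k j

open Classical in
/-- `S^∞`: the entry at `i, j` is the supremum of the entries of the powers of `S` if `j` is a
stationary state (that is `S j j = 1`), and `0` otherwise. -/
noncomputable def matInfty {I : Type} (S : I → I → ℝ≥0∞) (i j : I) : ℝ≥0∞ :=
  if S j j = 1 then ⨆ n : ℕ, matPow S n i j else 0

/-! ## Probabilistic coherence spaces -/

/-- The pairing of two families of non-negative coefficients. -/
noncomputable def pairing {I : Type} (u u' : I → ℝ≥0∞) : ℝ≥0∞ := ∑' i, u i * u' i

/-- The orthogonal of a set of families. -/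
def orth {I : Type} (S : Set (I → ℝ≥0∞)) : Set (I → ℝ≥0∞) :=
  {u' | ∀ u ∈ S, pairing u u' ≤ 1}

/-- Probabilistic coherence spaces. Coefficients are allowed to range over `[0, ∞]`, but the last
two conditions force all the coefficients of the elements of `P` and of `orth P` to be finite, so
that these objects are the same as those defined with coefficients in `[0, ∞)`. -/
structure PCS where
  web : Type
  countable : Countable web
  P : Set (web → ℝ≥0∞)
  biorth : orth (orth P) = P
  pos : ∀ a : web, ∃ u ∈ P, 0 < u a
  bdd : ∀ a : web, ∃ A : ℝ≥0∞, 0 < A ∧ A ≠ ∞ ∧ ∀ u ∈ P, u a ≤ A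

theorem pairing_comm {I : Type} (u v : I → ℝ≥0∞) : pairing u v = pairing v u := by
  simp only [pairing, mul_comm]

theorem orth_anti {I : Type} {S T : Set (I → ℝ≥0∞)} (h : S ⊆ T) : orth T ⊆ orth S :=
  fun _ hu v hv => hu v (h hv)

theorem subset_biorth {I : Type} (S : Set (I → ℝ≥0∞)) : S ⊆ orth (orth S) :=
  fun u hu v hv => by rw [pairing_comm]; exact hv u hu

theorem triorth {I : Type} (S : Set (I → ℝ≥0∞)) : orth (orth (orth S)) = orth S :=
  Set.Subset.antisymm (orth_anti (subset_biorth S)) (subset_biorth _)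

theorem pairing_mono {I : Type} {u v : I → ℝ≥0∞} (h : ∀ a, u a ≤ v a) (w : I → ℝ≥0∞) :
    pairing u w ≤ pairing v w :=
  ENNReal.tsum_le_tsum fun a => mul_le_mul_left (h a) _

theorem pairing_single {I : Type} (u : I → ℝ≥0∞) (a : I) (c : ℝ≥0∞)
    [DecidablePred fun b : I => b = a] :
    pairing u (fun b => if b = a then c else 0) = u a * c := by
  rw [pairing, tsum_eq_single a]
  · simp
  · intro b hb
    simp [hb]

theorem PCS.mem_iff (X : PCS) (u : X.web → ℝ≥0∞) :
    u ∈ X.P ↔ ∀ u' ∈ orth X.P, pairing u u' ≤ 1 := by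
  constructor
  · intro h u' hu'
    exact hu' u h
  · intro h
    rw [← X.biorth]
    intro v hv
    rw [pairing_comm]
    exact h v hv

theorem PCS.mem_of_le (X : PCS) {u v : X.web → ℝ≥0∞} (hv : v ∈ X.P) (h : ∀ a, u a ≤ v a) :
    u ∈ X.P :=
  (X.mem_iff u).2 fun w hw => (pairing_mono h w).trans ((X.mem_iff v).1 hv w hw)

theorem PCS.sum_mem (X : PCS) {ι : Type} (w : ι → ℝ≥0∞) (hw : ∑' i, w i ≤ 1)
    (v : ι → X.web → ℝ≥0∞) (hv : ∀ i, v i ∈ X.P) : (fun a => ∑' i, w i * v i a) ∈ X.P := by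
  refine (X.mem_iff _).2 fun u' hu' => ?_
  have : pairing (fun a => ∑' i, w i * v i a) u' = ∑' i, w i * pairing (v i) u' := by
    simp only [pairing, ← ENNReal.tsum_mul_right, ← ENNReal.tsum_mul_left]
    rw [ENNReal.tsum_comm]
    simp only [mul_assoc]
  rw [this]
  refine le_trans (ENNReal.tsum_le_tsum fun i => ?_) hw
  calc w i * pairing (v i) u' ≤ w i * 1 := mul_le_mul_right ((X.mem_iff _).1 (hv i) u' hu') _
    _ = w i := mul_one _

theorem PCS.zero_mem (X : PCS) : (fun _ => 0 : X.web → ℝ≥0∞) ∈ X.P :=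
  (X.mem_iff _).2 fun w _ => by simp [pairing]

theorem tsum_iSup_of_monotone {I : Type} (f : ℕ → I → ℝ≥0∞) (hf : ∀ a, Monotone fun n => f n a) :
    ∑' a, ⨆ n, f n a = ⨆ n, ∑' a, f n a := by
  simp only [ENNReal.tsum_eq_iSup_sum]
  rw [iSup_comm]
  congr 1
  funext s
  exact ENNReal.finsetSum_iSup_of_monotone fun a => hf a

theorem PCS.iSup_mem (X : PCS) (v : ℕ → X.web → ℝ≥0∞) (hm : ∀ a, Monotone fun n => v n a)
    (hv : ∀ n, v n ∈ X.P) : (fun a => ⨆ n, v n a) ∈ X.P := by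
  refine (X.mem_iff _).2 fun u' hu' => ?_
  have : pairing (fun a => ⨆ n, v n a) u' = ⨆ n, pairing (v n) u' := by
    simp only [pairing, ENNReal.iSup_mul]
    exact tsum_iSup_of_monotone _ fun a m n h => mul_le_mul_left (hm a h) _
  rw [this]
  exact iSup_le fun n => (X.mem_iff _).1 (hv n) u' hu'

/-- The space of natural numbers: the sub-probability distributions on `ℕ`. -/
noncomputable def natObj : PCS where
  web := ℕ
  countable := inferInstance
  P := {u | ∑' n, u n ≤ 1}
  biorth := by
    refine Set.Subset.antisymm (fun u hu => ?_) (subset_biorth _)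
    have h := hu (fun _ => 1) (fun v hv => by simpa [pairing] using hv)
    simpa [pairing] using h
  pos := fun a => ⟨fun b => if b = a then 1 else 0, by simp, by simp⟩
  bdd := fun a => ⟨1, by simp, by simp, fun u hu => (ENNReal.le_tsum a).trans hu⟩

/-- The terminal space, with an empty web. -/
def topObj : PCS where
  web := Empty
  countable := inferInstance
  P := Set.univ
  biorth := Set.Subset.antisymm (Set.subset_univ _) (subset_biorth _)
  pos := fun a => a.elim
  bdd := fun a => a.elim

/-- The cartesian product `X & Y`. -/
def withObj (X Y : PCS) : PCS where
  web := X.web ⊕ Y.web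
  countable := by
    have := X.countable
    have := Y.countable
    infer_instance
  P := {u | (fun a => u (Sum.inl a)) ∈ X.P ∧ (fun b => u (Sum.inr b)) ∈ Y.P}
  biorth := by
    refine Set.Subset.antisymm (fun u hu => ⟨?_, ?_⟩) (subset_biorth _)
    · refine (X.mem_iff _).2 fun u' hu' => ?_
      have h := hu (Sum.elim u' fun _ => 0) fun v hv => by
        have := hu' _ hv.1
        simpa [pairing, ENNReal.summable.tsum_sum] using this
      rw [pairing_comm] at h
      simpa [pairing, ENNReal.summable.tsum_sum] using h
    · refine (Y.mem_iff _).2 fun u' hu' => ?_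
      have h := hu (Sum.elim (fun _ => 0) u') fun v hv => by
        have := hu' _ hv.2
        simpa [pairing, ENNReal.summable.tsum_sum] using this
      rw [pairing_comm] at h
      simpa [pairing, ENNReal.summable.tsum_sum] using h
  pos := by
    rintro (a | b)
    · obtain ⟨u, hu, h⟩ := X.pos a
      exact ⟨Sum.elim u fun _ => 0, ⟨hu, Y.zero_mem⟩, h⟩
    · obtain ⟨u, hu, h⟩ := Y.pos b
      exact ⟨Sum.elim (fun _ => 0) u, ⟨X.zero_mem, hu⟩, h⟩
  bdd := by
    rintro (a | b)
    · obtain ⟨A, h0, h1, h⟩ := X.bdd a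
      exact ⟨A, h0, h1, fun u hu => h _ hu.1⟩
    · obtain ⟨A, h0, h1, h⟩ := Y.bdd b
      exact ⟨A, h0, h1, fun u hu => h _ hu.2⟩

/-- Application of a matrix to a vector. -/
noncomputable def matApp {I J : Type} (t : I × J → ℝ≥0∞) (u : I → ℝ≥0∞) : J → ℝ≥0∞ :=
  fun b => ∑' a, t (a, b) * u a

theorem pairing_matApp {I J : Type} (t : I × J → ℝ≥0∞) (u : I → ℝ≥0∞) (v : J → ℝ≥0∞) :
    pairing (matApp t u) v = pairing u (fun a => ∑' b, t (a, b) * v b) := by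
  simp only [pairing, matApp, ← ENNReal.tsum_mul_right, ← ENNReal.tsum_mul_left]
  rw [ENNReal.tsum_comm]
  refine tsum_congr fun a => tsum_congr fun b => ?_
  ring

/-- The space `X ⊸ Y` of linear morphisms: the matrices that map `P X` to `P Y`. -/
noncomputable def linObj (X Y : PCS) : PCS where
  web := X.web × Y.web
  countable := by
    have := X.countable
    have := Y.countable
    infer_instance
  P := {t | ∀ u ∈ X.P, matApp t u ∈ Y.P}
  biorth := by
    refine Set.Subset.antisymm (fun t ht u hu => ?_) (subset_biorth _)
    refine (Y.mem_iff _).2 fun v hv => ?_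
    have key : ∀ s : X.web × Y.web → ℝ≥0∞,
        pairing s (fun p => u p.1 * v p.2) = pairing (matApp s u) v := by
      intro s
      simp only [pairing, matApp, ← ENNReal.tsum_mul_right]
      rw [ENNReal.tsum_prod', ENNReal.tsum_comm]
      refine tsum_congr fun b => tsum_congr fun a => ?_
      ring
    have h := ht (fun p => u p.1 * v p.2) fun s hs => by
      rw [key]
      exact (Y.mem_iff _).1 (hs u hu) v hv
    rw [pairing_comm, key] at h
    exact h
  pos := by
    classical
    rintro ⟨a, b⟩
    obtain ⟨A, h0, h1, hA⟩ := X.bdd a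
    obtain ⟨v, hv, hb⟩ := Y.pos b
    refine ⟨fun p => if p.1 = a then A⁻¹ * v p.2 else 0, fun u hu => ?_, ?_⟩
    · refine Y.mem_of_le hv fun b' => ?_
      have : matApp (fun p : X.web × Y.web => if p.1 = a then A⁻¹ * v p.2 else 0) u b'
          = A⁻¹ * v b' * u a := by
        simp [matApp, tsum_ite_eq]
      rw [this]
      calc A⁻¹ * v b' * u a ≤ A⁻¹ * v b' * A := mul_le_mul_right (hA u hu) _
        _ = (A⁻¹ * A) * v b' := by ring
        _ = v b' := by rw [ENNReal.inv_mul_cancel h0.ne' h1, one_mul]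
    · simp only [if_true]
      exact ENNReal.mul_pos (ENNReal.inv_ne_zero.2 h1) hb.ne'
  bdd := by
    rintro ⟨a, b⟩
    obtain ⟨u, hu, ha⟩ := X.pos a
    obtain ⟨A', h0', h1', hA'⟩ := X.bdd a
    obtain ⟨B, h0, h1, hB⟩ := Y.bdd b
    have hfin : u a ≠ ∞ := ne_top_of_le_ne_top h1' (hA' u hu)
    refine ⟨B / u a, ENNReal.div_pos h0.ne' hfin, ENNReal.div_ne_top h1 ha.ne', fun t ht => ?_⟩
    rw [ENNReal.le_div_iff_mul_le (Or.inl ha.ne') (Or.inl hfin)]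
    exact (ENNReal.le_tsum (f := fun a => t (a, b) * u a) a).trans (hB _ (ht u hu))

/-- `u^μ`, the product of the `u a` for `a` in the multiset `μ`. As a family indexed by `μ`, this
is the promotion `u^!` of `u`. -/
noncomputable def promVec {I : Type} (u : I → ℝ≥0∞) (μ : Multiset I) : ℝ≥0∞ := (μ.map u).prod

theorem PCS.exists_pos (X : PCS) (μ : Multiset X.web) : ∃ u ∈ X.P, ∀ a ∈ μ, 0 < u a := by
  induction μ using Multiset.induction with
  | empty => exact ⟨_, X.zero_mem, by simp⟩
  | cons a μ ih =>
    obtain ⟨u, hu, h⟩ := ih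
    obtain ⟨v, hv, hva⟩ := X.pos a
    refine ⟨_, X.sum_mem (fun _ : Bool => 2⁻¹) ?_ (fun i => cond i u v) ?_, ?_⟩
    · simp [tsum_fintype]
    · rintro (_ | _)
      · exact hv
      · exact hu
    · intro b hb
      have h2 : (2⁻¹ : ℝ≥0∞) ≠ 0 := by simp
      simp only [tsum_fintype, Fintype.sum_bool, cond_true, cond_false]
      rcases Multiset.mem_cons.1 hb with rfl | hb
      · exact (ENNReal.mul_pos h2 hva.ne').trans_le le_add_self
      · exact (ENNReal.mul_pos h2 (h b hb).ne').trans_le le_self_add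

theorem PCS.exists_bdd (X : PCS) (μ : Multiset X.web) :
    ∃ A : ℝ≥0∞, 0 < A ∧ A ≠ ∞ ∧ ∀ u ∈ X.P, promVec u μ ≤ A := by
  induction μ using Multiset.induction with
  | empty => exact ⟨1, by simp, by simp, by simp [promVec]⟩
  | cons a μ ih =>
    obtain ⟨A, h0, h1, h⟩ := ih
    obtain ⟨B, h0', h1', h'⟩ := X.bdd a
    refine ⟨B * A, ENNReal.mul_pos h0'.ne' h0.ne', ENNReal.mul_ne_top h1' h1, fun u hu => ?_⟩
    have := mul_le_mul' (h' u hu) (h u hu)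
    simpa [promVec] using this

theorem promVec_pos {I : Type} (u : I → ℝ≥0∞) (μ : Multiset I) (h : ∀ a ∈ μ, 0 < u a) :
    0 < promVec u μ := by
  induction μ using Multiset.induction with
  | empty => simp [promVec]
  | cons a μ ih =>
    have h1 := ih fun b hb => h b (Multiset.mem_cons_of_mem hb)
    have h2 := h a (Multiset.mem_cons_self a μ)
    have := ENNReal.mul_pos h2.ne' h1.ne'
    simpa [promVec] using this

/-- The exponential `!X`, whose web is the set of finite multisets of elements of the web of `X`. -/
noncomputable def exclObj (X : PCS) : PCS where
  web := Multiset X.web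
  countable := by
    have := X.countable
    infer_instance
  P := orth (orth {U | ∃ u ∈ X.P, U = promVec u})
  biorth := triorth _
  pos := fun μ => by
    obtain ⟨u, hu, h⟩ := X.exists_pos μ
    exact ⟨promVec u, subset_biorth _ ⟨u, hu, rfl⟩, promVec_pos u μ h⟩
  bdd := fun μ => by
    classical
    obtain ⟨A, h0, h1, h⟩ := X.exists_bdd μ
    refine ⟨A, h0, h1, fun U hU => ?_⟩
    have := hU (fun ν => if ν = μ then A⁻¹ else 0) (by
      rintro _ ⟨u, hu, rfl⟩
      refine (pairing_single (promVec u) μ A⁻¹).le.trans ?_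
      calc promVec u μ * A⁻¹ ≤ A * A⁻¹ := mul_le_mul_left (h u hu) _
        _ = 1 := ENNReal.mul_inv_cancel h0.ne' h1)
    have h2 := pairing_single U μ A⁻¹
    rw [pairing_comm, h2, ← div_eq_mul_inv] at this
    have h3 := (ENNReal.div_le_iff_le_mul (Or.inl h0.ne') (Or.inl h1)).1 this
    rwa [one_mul] at h3

/-- `X ⇒ Y`, that is `!X ⊸ Y`. -/
noncomputable def impObj (X Y : PCS) : PCS := linObj (exclObj X) Y

/-- Morphisms from `X` to `Y` in the Kleisli category of the exponential comonad: the linear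
morphisms from `!X` to `Y`. -/
def Kl (X Y : PCS) : Type :=
  {t : Multiset X.web × Y.web → ℝ≥0∞ // t ∈ (impObj X Y).P}

/-- The function associated with a matrix `s` indexed by `Multiset I × J`, given by
`(fn s u)_b = ∑_μ s_{μ,b} u^μ`. -/
noncomputable def fn {I J : Type} (s : Multiset I × J → ℝ≥0∞) (u : I → ℝ≥0∞) : J → ℝ≥0∞ :=
  matApp s (promVec u)

/-- A matrix is a Kleisli morphism as soon as its function maps `P X` to `P Y`. -/
theorem mem_impObj {X Y : PCS} (s : Multiset X.web × Y.web → ℝ≥0∞) :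
    s ∈ (impObj X Y).P ↔ ∀ u ∈ X.P, fn s u ∈ Y.P := by
  constructor
  · intro h u hu
    exact h _ (subset_biorth _ ⟨u, hu, rfl⟩)
  · intro h U hU
    refine (Y.mem_iff _).2 fun v hv => ?_
    refine (pairing_matApp (I := Multiset X.web) s U v).le.trans ?_
    refine (pairing_comm (I := Multiset X.web) U _).le.trans ?_
    refine hU _ ?_
    rintro _ ⟨u, hu, rfl⟩
    rw [← pairing_matApp]
    exact (Y.mem_iff _).1 (h u hu) v hv

/-! ## The interpretation of the constructions of the language as matrices

Each matrix comes with a lemma that computes the associated function. -/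

open Classical in
/-- `(x ⋆ y)_m = ∑_{m₁ + m₂ = m} x_{m₁} y_{m₂}`: contraction, followed by `x ⊗ y`. -/
noncomputable def conv {I : Type} (x y : Multiset I → ℝ≥0∞) (m : Multiset I) : ℝ≥0∞ :=
  ∑' p : Multiset I × Multiset I, if p.1 + p.2 = m then x p.1 * y p.2 else 0

theorem promVec_zero {I : Type} (u : I → ℝ≥0∞) : promVec u 0 = 1 := by simp [promVec]

theorem promVec_cons {I : Type} (u : I → ℝ≥0∞) (a : I) (m : Multiset I) :
    promVec u (a ::ₘ m) = u a * promVec u m := by simp [promVec]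

theorem promVec_add {I : Type} (u : I → ℝ≥0∞) (m m' : Multiset I) :
    promVec u (m + m') = promVec u m * promVec u m' := by simp [promVec]

open Classical in
theorem tsum_conv_mul {I : Type} (x y g : Multiset I → ℝ≥0∞) :
    ∑' m, conv x y m * g m = ∑' p : Multiset I × Multiset I, x p.1 * y p.2 * g (p.1 + p.2) := by
  simp only [conv, ← ENNReal.tsum_mul_right]
  rw [ENNReal.tsum_comm]
  refine tsum_congr fun p => ?_
  rw [tsum_eq_single (p.1 + p.2)]
  · simp
  · intro m hm
    simp [hm.symm]

theorem pairing_conv {I : Type} (x y : Multiset I → ℝ≥0∞) (u : I → ℝ≥0∞) :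
    pairing (conv x y) (promVec u) = pairing x (promVec u) * pairing y (promVec u) := by
  rw [pairing, tsum_conv_mul, ENNReal.tsum_prod']
  simp only [pairing, ← ENNReal.tsum_mul_right, ← ENNReal.tsum_mul_left, promVec_add]
  rw [ENNReal.tsum_comm]
  refine tsum_congr fun a => tsum_congr fun b => ?_
  ring

theorem conv_left_comm {I : Type} (x y z : Multiset I → ℝ≥0∞) :
    conv x (conv y z) = conv y (conv x z) := by
  classical
  have key : ∀ x y z : Multiset I → ℝ≥0∞, ∀ m, conv x (conv y z) m
      = ∑' a, ∑' b, ∑' c, if a + (b + c) = m then x a * (y b * z c) else 0 := by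
    intro x y z m
    have h := fun a => tsum_conv_mul y z (fun k => if a + k = m then x a else 0)
    simp only [mul_ite, mul_zero] at h
    rw [conv, ENNReal.tsum_prod']
    refine tsum_congr fun a => ?_
    rw [← ENNReal.tsum_prod' (f := fun p : Multiset I × Multiset I =>
      if a + (p.1 + p.2) = m then x a * (y p.1 * z p.2) else 0)]
    simp only [mul_comm (x a)]
    exact h a
  funext m
  rw [key, key, ENNReal.tsum_comm]
  refine tsum_congr fun b => tsum_congr fun a => tsum_congr fun c => ?_
  rw [add_left_comm, mul_left_comm]

instance convLeftComm {I J : Type} (f : Multiset I × J → ℝ≥0∞) :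
    LeftCommutative fun (b : J) (acc : Multiset I → ℝ≥0∞) => conv (fun m => f (m, b)) acc :=
  ⟨fun _ _ _ => conv_left_comm _ _ _⟩

open Classical in
/-- The promotion `f^! : !X → !Y` of `f : !X → Y`. Its coefficient at `(m, [b₁, …, b_k])` is
`∑_{m₁ + ⋯ + m_k = m} f_{m₁,b₁} ⋯ f_{m_k,b_k}`. -/
noncomputable def prom {I J : Type} (f : Multiset I × J → ℝ≥0∞) (ν : Multiset J) :
    Multiset I → ℝ≥0∞ :=
  Multiset.foldr (fun (b : J) (acc : Multiset I → ℝ≥0∞) => conv (fun m => f (m, b)) acc)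
    (fun m => if m = 0 then 1 else 0) ν

theorem fn_apply {I J : Type} (s : Multiset I × J → ℝ≥0∞) (u : I → ℝ≥0∞) (b : J) :
    fn s u b = pairing (fun m => s (m, b)) (promVec u) := rfl

theorem pairing_prom {I J : Type} (f : Multiset I × J → ℝ≥0∞) (ν : Multiset J) (u : I → ℝ≥0∞) :
    pairing (prom f ν) (promVec u) = promVec (fn f u) ν := by
  classical
  induction ν using Multiset.induction with
  | empty =>
    rw [pairing_comm, prom, Multiset.foldr_zero, pairing_single, promVec_zero, promVec_zero,
      one_mul]
  | cons b ν ih =>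
    rw [prom, Multiset.foldr_cons, ← prom, pairing_conv, ih, promVec_cons, fn_apply]

open Classical in
/-- The matrix with a single non-zero row, at the empty multiset, which is `v`. -/
noncomputable def constMat {I J : Type} (v : J → ℝ≥0∞) (p : Multiset I × J) : ℝ≥0∞ :=
  if p.1 = 0 then v p.2 else 0

theorem fn_constMat {I J : Type} (v : J → ℝ≥0∞) (u : I → ℝ≥0∞) :
    fn (constMat (I := I) v) u = v := by
  classical
  funext b
  rw [fn_apply, pairing_comm]
  simp only [constMat]
  rw [pairing_single, promVec_zero, one_mul]

open Classical in
/-- The projection along an inclusion of webs. -/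
noncomputable def projMat {I J : Type} (i : J → I) (p : Multiset I × J) : ℝ≥0∞ :=
  if p.1 = {i p.2} then 1 else 0

theorem fn_projMat {I J : Type} (i : J → I) (u : I → ℝ≥0∞) :
    fn (projMat i) u = fun b => u (i b) := by
  classical
  funext b
  rw [fn_apply, pairing_comm]
  simp only [projMat]
  rw [pairing_single, mul_one]
  simp [promVec]

/-- The successor, applied to a family of coefficients. -/
def sucVec (v : ℕ → ℝ≥0∞) : ℕ → ℝ≥0∞
  | 0 => 0
  | n + 1 => v n

/-- The composition of a matrix with the successor. -/
def sucMat {I : Type} (s : Multiset I × ℕ → ℝ≥0∞) (p : Multiset I × ℕ) : ℝ≥0∞ :=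
  sucVec (fun n => s (p.1, n)) p.2

theorem fn_sucMat {I : Type} (s : Multiset I × ℕ → ℝ≥0∞) (u : I → ℝ≥0∞) :
    fn (sucMat s) u = sucVec (fn s u) := by
  funext n
  cases n with
  | zero => simp [fn_apply, sucMat, sucVec, pairing]
  | succ n => rfl

/-- Application: contraction, then `s ⊗ t^!`, then evaluation. -/
noncomputable def appMat {I J K : Type} (s : Multiset I × (Multiset J × K) → ℝ≥0∞)
    (t : Multiset I × J → ℝ≥0∞) (p : Multiset I × K) : ℝ≥0∞ :=
  ∑' ν : Multiset J, conv (fun m => s (m, (ν, p.2))) (prom t ν) p.1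

theorem pairing_tsum_left {I A : Type} (x : A → I → ℝ≥0∞) (w : I → ℝ≥0∞) :
    pairing (fun i => ∑' a, x a i) w = ∑' a, pairing (x a) w := by
  simp only [pairing, ← ENNReal.tsum_mul_right]
  exact ENNReal.tsum_comm

theorem pairing_add_left {I : Type} (x y w : I → ℝ≥0∞) :
    pairing (fun i => x i + y i) w = pairing x w + pairing y w := by
  simp only [pairing, add_mul]
  exact ENNReal.tsum_add

theorem fn_appMat {I J K : Type} (s : Multiset I × (Multiset J × K) → ℝ≥0∞)
    (t : Multiset I × J → ℝ≥0∞) (u : I → ℝ≥0∞) :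
    fn (appMat s t) u = fn (fn s u) (fn t u) := by
  funext b
  rw [fn_apply]
  simp only [appMat]
  rw [pairing_tsum_left]
  simp only [pairing_conv, pairing_prom]
  rfl

/-- Currying. -/
def curMat {I J K : Type} (s : Multiset (I ⊕ J) × K → ℝ≥0∞)
    (p : Multiset I × (Multiset J × K)) : ℝ≥0∞ :=
  s (p.1.map Sum.inl + p.2.1.map Sum.inr, p.2.2)

/-- A multiset on a disjoint union is a pair of multisets. -/
def sumEquiv (I J : Type) : Multiset I × Multiset J ≃ Multiset (I ⊕ J) where
  toFun p := p.1.map Sum.inl + p.2.map Sum.inr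
  invFun m := (m.filterMap Sum.getLeft?, m.filterMap Sum.getRight?)
  left_inv p := by
    have h1 : ∀ l : Multiset I, (l.map (Sum.inl (β := J))).filterMap Sum.getLeft? = l := by
      intro l
      rw [Multiset.filterMap_map]
      exact Multiset.filterMap_some l
    have h2 : ∀ l : Multiset J, (l.map (Sum.inr (α := I))).filterMap Sum.getRight? = l := by
      intro l
      rw [Multiset.filterMap_map]
      exact Multiset.filterMap_some l
    have h3 : ∀ l : Multiset J, (l.map (Sum.inr (α := I))).filterMap Sum.getLeft? = 0 := by
      intro l
      induction l using Multiset.induction with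
      | empty => simp
      | cons a l ih =>
        rw [Multiset.map_cons, Multiset.filterMap_cons_none _ _ rfl, ih]
    have h4 : ∀ l : Multiset I, (l.map (Sum.inl (β := J))).filterMap Sum.getRight? = 0 := by
      intro l
      induction l using Multiset.induction with
      | empty => simp
      | cons a l ih =>
        rw [Multiset.map_cons, Multiset.filterMap_cons_none _ _ rfl, ih]
    ext1 <;> simp [Multiset.filterMap_add, h1, h2, h3, h4]
  right_inv m := by
    induction m using Multiset.induction with
    | empty => simp
    | cons a m ih =>
      dsimp only at ih ⊢
      rcases a with a | a
      · rw [Multiset.filterMap_cons_some Sum.getLeft? (Sum.inl a) m (b := a) rfl,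
          Multiset.filterMap_cons_none (f := Sum.getRight?) (Sum.inl a) m rfl,
          Multiset.map_cons, Multiset.cons_add, ih]
      · rw [Multiset.filterMap_cons_some Sum.getRight? (Sum.inr a) m (b := a) rfl,
          Multiset.filterMap_cons_none (f := Sum.getLeft?) (Sum.inr a) m rfl,
          Multiset.map_cons, Multiset.add_cons, ih]

theorem promVec_elim {I J : Type} (u : I → ℝ≥0∞) (v : J → ℝ≥0∞) (p : Multiset I × Multiset J) :
    promVec (Sum.elim u v) (p.1.map Sum.inl + p.2.map Sum.inr)
      = promVec u p.1 * promVec v p.2 := by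
  rw [promVec_add]
  simp [promVec, Multiset.map_map]

theorem fn_elim {I J K : Type} (s : Multiset (I ⊕ J) × K → ℝ≥0∞) (u : I → ℝ≥0∞)
    (v : J → ℝ≥0∞) (b : K) :
    fn s (Sum.elim u v) b
      = ∑' p : Multiset J, (∑' m : Multiset I,
          s (m.map Sum.inl + p.map Sum.inr, b) * promVec u m) * promVec v p := by
  rw [fn_apply, pairing, ← (sumEquiv I J).tsum_eq, ENNReal.tsum_prod', ENNReal.tsum_comm]
  refine tsum_congr fun p => ?_
  rw [← ENNReal.tsum_mul_right]
  refine tsum_congr fun m => ?_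
  have := promVec_elim u v (m, p)
  simp only [sumEquiv, Equiv.coe_fn_mk] at this ⊢
  rw [this, mul_assoc]

theorem fn_curMat {I J K : Type} (s : Multiset (I ⊕ J) × K → ℝ≥0∞) (u : I → ℝ≥0∞)
    (v : J → ℝ≥0∞) : fn (fn (curMat s) u) v = fn s (Sum.elim u v) := by
  funext b
  rw [fn_elim]
  rfl

open Classical in
/-- The element of the space of natural numbers that represents `n`. -/
noncomputable def numVec (n : ℕ) (k : ℕ) : ℝ≥0∞ := if k = n then 1 else 0

/-- The composition of the last argument of a matrix with the coalgebra structure of the space of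
natural numbers, whose coefficient at `(n, μ)` is `1` if `μ = k[n]` for some `k`, and `0`
otherwise. -/
noncomputable def coalgMat {I K : Type} (r : Multiset (I ⊕ ℕ) × K → ℝ≥0∞) (n : ℕ)
    (p : Multiset I × K) : ℝ≥0∞ :=
  ∑' k : ℕ, r (p.1.map Sum.inl + (Multiset.replicate k n).map Sum.inr, p.2)

theorem promVec_numVec_replicate (n k : ℕ) : promVec (numVec n) (Multiset.replicate k n) = 1 := by
  simp [promVec, numVec]

theorem promVec_numVec_eq_zero (n : ℕ) (p : Multiset ℕ)
    (h : p ∉ Set.range fun k => Multiset.replicate k n) : promVec (numVec n) p = 0 := by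
  have : ∃ a ∈ p, a ≠ n := by
    by_contra! hc
    exact h ⟨p.card, (Multiset.eq_replicate_card.2 hc).symm⟩
  obtain ⟨a, ha, han⟩ := this
  refine Multiset.prod_eq_zero (Multiset.mem_map.2 ⟨a, ha, ?_⟩)
  simp [numVec, han]

theorem fn_coalgMat {I K : Type} (r : Multiset (I ⊕ ℕ) × K → ℝ≥0∞) (n : ℕ) (u : I → ℝ≥0∞) :
    fn (coalgMat r n) u = fn r (Sum.elim u (numVec n)) := by
  funext b
  have hinj : Function.Injective fun k => Multiset.replicate k n := by
    intro k l h
    simpa using congrArg Multiset.card h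
  rw [fn_elim, ← hinj.tsum_eq]
  · simp only [promVec_numVec_replicate, mul_one]
    rw [fn_apply]
    simp only [coalgMat]
    rw [pairing_tsum_left]
    rfl
  · intro p hp
    by_contra hc
    exact hp (by simp only [promVec_numVec_eq_zero n p hc, mul_zero])

/-- The conditional. -/
noncomputable def ifMat {I K : Type} (s : Multiset I × ℕ → ℝ≥0∞) (t : Multiset I × K → ℝ≥0∞)
    (r : Multiset (I ⊕ ℕ) × K → ℝ≥0∞) (p : Multiset I × K) : ℝ≥0∞ :=
  conv (fun m => s (m, 0)) (fun m => t (m, p.2)) p.1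
    + ∑' n : ℕ, conv (fun m => s (m, n + 1)) (fun m => coalgMat r n (m, p.2)) p.1

theorem fn_ifMat {I K : Type} (s : Multiset I × ℕ → ℝ≥0∞) (t : Multiset I × K → ℝ≥0∞)
    (r : Multiset (I ⊕ ℕ) × K → ℝ≥0∞) (u : I → ℝ≥0∞) :
    fn (ifMat s t r) u = fun b => fn s u 0 * fn t u b
      + ∑' n : ℕ, fn s u (n + 1) * fn r (Sum.elim u (numVec n)) b := by
  funext b
  rw [fn_apply]
  simp only [ifMat]
  rw [pairing_add_left, pairing_tsum_left]
  simp only [pairing_conv, ← fn_coalgMat]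
  rfl

/-- The approximations of the least fix-point: `0`, and then iterated application of `s`. -/
noncomputable def fixIter {I J : Type} (s : Multiset I × (Multiset J × J) → ℝ≥0∞) :
    ℕ → Multiset I × J → ℝ≥0∞
  | 0 => fun _ => 0
  | n + 1 => appMat s (fixIter s n)

/-- The least fix-point of `s`. -/
noncomputable def fixMat {I J : Type} (s : Multiset I × (Multiset J × J) → ℝ≥0∞)
    (p : Multiset I × J) : ℝ≥0∞ :=
  ⨆ n : ℕ, fixIter s n p

theorem conv_mono {I : Type} {x x' y y' : Multiset I → ℝ≥0∞} (hx : x ≤ x') (hy : y ≤ y') :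
    conv x y ≤ conv x' y' := by
  intro m
  refine ENNReal.tsum_le_tsum fun p => ?_
  split_ifs
  · exact mul_le_mul' (hx _) (hy _)
  · exact le_rfl

theorem prom_mono {I J : Type} {f g : Multiset I × J → ℝ≥0∞} (h : f ≤ g) (ν : Multiset J) :
    prom f ν ≤ prom g ν := by
  induction ν using Multiset.induction with
  | empty => simp only [prom, Multiset.foldr_zero]; exact le_rfl
  | cons b ν ih =>
    simp only [prom, Multiset.foldr_cons]
    exact conv_mono (fun m => h _) ih

theorem fixIter_mono {I J : Type} (s : Multiset I × (Multiset J × J) → ℝ≥0∞) :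
    Monotone (fixIter s) := by
  refine monotone_nat_of_le_succ fun n => ?_
  induction n with
  | zero => exact fun p => zero_le
  | succ n ih =>
    exact fun p => ENNReal.tsum_le_tsum fun ν => conv_mono le_rfl (prom_mono ih ν) _

theorem fn_fixIter {I J : Type} (s : Multiset I × (Multiset J × J) → ℝ≥0∞) (u : I → ℝ≥0∞)
    (n : ℕ) : fn (fixIter s n) u = (fn (fn s u))^[n] 0 := by
  induction n with
  | zero => funext b; simp [fn_apply, fixIter, pairing]
  | succ n ih => rw [Function.iterate_succ_apply', ← ih, ← fn_appMat]; rfl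

theorem fn_fixMat {I J : Type} (s : Multiset I × (Multiset J × J) → ℝ≥0∞) (u : I → ℝ≥0∞) :
    fn (fixMat s) u = fun b => ⨆ n : ℕ, (fn (fn s u))^[n] 0 b := by
  funext b
  simp only [← fn_fixIter]
  simp only [fn_apply, fixMat, pairing, ENNReal.iSup_mul]
  exact tsum_iSup_of_monotone _ fun m i j h => mul_le_mul_left (fixIter_mono s h _) _

/-! ## The interpretation of types and terms -/

/-- The interpretation of types. -/
noncomputable def Ty.sem : Ty → PCS
  | .nat => natObj
  | .imp σ τ => impObj σ.sem τ.sem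

/-- The interpretation of contexts. -/
noncomputable def ctxSem : Ctx → PCS
  | [] => topObj
  | σ :: Γ => withObj (ctxSem Γ) σ.sem

/-- The inclusion of the web of the type of a variable into the web of the context. -/
def Var.inj : {Γ : Ctx} → {σ : Ty} → Var Γ σ → σ.sem.web → (ctxSem Γ).web
  | _, _, .zero => fun a => Sum.inr a
  | _, _, .suc x => fun a => Sum.inl (x.inj a)

theorem Var.inj_mem {Γ : Ctx} {σ : Ty} (x : Var Γ σ) (u : (ctxSem Γ).web → ℝ≥0∞)
    (hu : u ∈ (ctxSem Γ).P) : (fun a => u (x.inj a)) ∈ σ.sem.P := by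
  induction x with
  | zero => exact hu.2
  | suc x ih => exact ih _ hu.1

theorem numVec_mem (n : ℕ) : numVec n ∈ natObj.P := by
  classical
  change ∑' k, numVec n k ≤ 1
  simp [numVec]

/-- The interpretation `p e₀ + (1 - p) e₁` of a coin. -/
noncomputable def coinVec (p : Set.Icc (0 : ℚ) 1) (k : ℕ) : ℝ≥0∞ :=
  ENNReal.ofReal ((p : ℚ) : ℝ) * numVec 0 k + ENNReal.ofReal (1 - ((p : ℚ) : ℝ)) * numVec 1 k

theorem coinVec_mem (p : Set.Icc (0 : ℚ) 1) : coinVec p ∈ natObj.P := by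
  classical
  change ∑' k, coinVec p k ≤ 1
  have h0 : (0 : ℝ) ≤ ((p : ℚ) : ℝ) := by exact_mod_cast p.2.1
  have h1 : ((p : ℚ) : ℝ) ≤ 1 := by exact_mod_cast p.2.2
  simp only [coinVec]
  rw [ENNReal.tsum_add, ENNReal.tsum_mul_left, ENNReal.tsum_mul_left]
  simp only [numVec, tsum_ite_eq, mul_one]
  rw [← ENNReal.ofReal_add h0 (by linarith)]
  simp

theorem sucVec_mem (v : ℕ → ℝ≥0∞) (hv : v ∈ natObj.P) : sucVec v ∈ natObj.P := by
  change ∑' k, sucVec v k ≤ 1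
  rw [tsum_eq_zero_add' ENNReal.summable]
  refine le_trans (le_of_eq ?_) hv
  simp [sucVec]

theorem elim_mem {X Y : PCS} {u : X.web → ℝ≥0∞} {v : Y.web → ℝ≥0∞} (hu : u ∈ X.P)
    (hv : v ∈ Y.P) : (Sum.elim u v : (withObj X Y).web → ℝ≥0∞) ∈ (withObj X Y).P :=
  ⟨hu, hv⟩

theorem constMat_mem {X Y : PCS} {v : Y.web → ℝ≥0∞} (hv : v ∈ Y.P) :
    constMat v ∈ (impObj X Y).P :=
  (mem_impObj _).2 fun u _ => by rw [fn_constMat]; exact hv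

theorem projMat_mem {X Y : PCS} {i : Y.web → X.web}
    (hi : ∀ u ∈ X.P, (fun a => u (i a)) ∈ Y.P) : projMat i ∈ (impObj X Y).P :=
  (mem_impObj _).2 fun u hu => by rw [fn_projMat]; exact hi u hu

theorem sucMat_mem {X : PCS} {s : Multiset X.web × ℕ → ℝ≥0∞} (hs : s ∈ (impObj X natObj).P) :
    sucMat s ∈ (impObj X natObj).P := by
  refine (mem_impObj (Y := natObj) _).2 fun u hu => ?_
  refine (fn_sucMat s u).symm ▸ ?_
  exact sucVec_mem _ ((mem_impObj (Y := natObj) s).1 hs u hu)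

theorem appMat_mem {X Y Z : PCS} {s : Multiset X.web × (Multiset Y.web × Z.web) → ℝ≥0∞}
    {t : Multiset X.web × Y.web → ℝ≥0∞} (hs : s ∈ (impObj X (impObj Y Z)).P)
    (ht : t ∈ (impObj X Y).P) : appMat s t ∈ (impObj X Z).P := by
  refine (mem_impObj _).2 fun u hu => ?_
  rw [fn_appMat]
  exact (mem_impObj (X := Y) (Y := Z) _).1 ((mem_impObj (Y := impObj Y Z) s).1 hs u hu) _
    ((mem_impObj t).1 ht u hu)

theorem curMat_mem {X Y Z : PCS} {s : Multiset (X.web ⊕ Y.web) × Z.web → ℝ≥0∞}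
    (hs : s ∈ (impObj (withObj X Y) Z).P) : curMat s ∈ (impObj X (impObj Y Z)).P := by
  refine (mem_impObj (Y := impObj Y Z) _).2 fun u hu => ?_
  refine (mem_impObj (X := Y) (Y := Z) _).2 fun v hv => ?_
  refine (fn_curMat s u v).symm ▸ ?_
  exact (mem_impObj (X := withObj X Y) s).1 hs _ (elim_mem hu hv)

theorem ifMat_mem {X Z : PCS} {s : Multiset X.web × ℕ → ℝ≥0∞}
    {t : Multiset X.web × Z.web → ℝ≥0∞} {r : Multiset (X.web ⊕ ℕ) × Z.web → ℝ≥0∞}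
    (hs : s ∈ (impObj X natObj).P) (ht : t ∈ (impObj X Z).P)
    (hr : r ∈ (impObj (withObj X natObj) Z).P) : ifMat s t r ∈ (impObj X Z).P := by
  refine (mem_impObj _).2 fun u hu => ?_
  have h := Z.sum_mem (fn s u) ((mem_impObj (Y := natObj) s).1 hs u hu)
    (fun n => Nat.rec (fn t u) (fun n _ => fn r (Sum.elim u (numVec n))) n) (by
      rintro (_ | n)
      · exact (mem_impObj t).1 ht u hu
      · exact (mem_impObj (X := withObj X natObj) r).1 hr _ (elim_mem hu (numVec_mem n)))
  rw [fn_ifMat]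
  have e := fun a => tsum_eq_zero_add' (f := fun i => fn s u i *
    Nat.rec (motive := fun _ => Z.web → ℝ≥0∞) (fn t u)
      (fun n _ => fn r (Sum.elim u (numVec n))) i a) ENNReal.summable
  exact (funext e : _ = _) ▸ h

theorem fixMat_mem {X Y : PCS} {s : Multiset X.web × (Multiset Y.web × Y.web) → ℝ≥0∞}
    (hs : s ∈ (impObj X (impObj Y Y)).P) : fixMat s ∈ (impObj X Y).P := by
  refine (impObj X Y).iSup_mem (fixIter s) (fun p i j h => fixIter_mono s h p) fun n => ?_
  induction n with
  | zero => exact (impObj X Y).zero_mem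
  | succ n ih => exact appMat_mem hs ih

/-- The interpretation of a term `M` such that `Γ ⊢ M : σ`, as a Kleisli morphism from the
interpretation of `Γ` to the interpretation of `σ`. -/
noncomputable def Term.sem : {Γ : Ctx} → {σ : Ty} → Term Γ σ → Kl (ctxSem Γ) σ.sem
  | _, _, .num n => ⟨constMat (numVec n), constMat_mem (Y := natObj) (numVec_mem n)⟩
  | _, _, .var x => ⟨projMat x.inj, projMat_mem x.inj_mem⟩
  | _, _, .succ M => ⟨sucMat M.sem.1, sucMat_mem M.sem.2⟩
  | _, _, .ifz M P R => ⟨ifMat M.sem.1 P.sem.1 R.sem.1, ifMat_mem M.sem.2 P.sem.2 R.sem.2⟩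
  | _, _, .lam M => ⟨curMat M.sem.1, curMat_mem M.sem.2⟩
  | _, _, .app M N => ⟨appMat M.sem.1 N.sem.1, appMat_mem M.sem.2 N.sem.2⟩
  | _, _, .coin p => ⟨constMat (coinVec p), constMat_mem (Y := natObj) (coinVec_mem p)⟩
  | _, _, .fix M => ⟨fixMat M.sem.1, fixMat_mem M.sem.2⟩

/-- The `n`-th coefficient of the interpretation of a closed term of type `nat`. The web of the
interpretation of the empty context is empty, and the only multiset on it is the empty one. -/
noncomputable def Term.natCoeff (M : Term [] Ty.nat) (n : ℕ) : ℝ≥0∞ :=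
  M.sem.1 ((0 : Multiset Empty), n)

end PPCF

open scoped ENNReal

namespace PPCF

/-! ## Syntactic properties of substitution -/

/-! Fix `n`. As functions of the closed term `M`, the probability of reaching the numeral and the
`n`-th coefficient both solve the one-step equation `f M = ∑ M', S M M' * f M'` (`iSup_numProb`,
`tsum_redMatrix_natCoeff`). The probability is the least solution that is at least `1` at the
numeral, which gives one inequality by induction on the number of steps (`numProb_le_natCoeff`).

The equation for coefficients is invariance under reduction (`eqv_den_wsum`). At a redex it comes
from the substitution lemma `eqv_den_subst` and the fixed-point equation `den_fix_eq_ap`. Below an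
evaluation context it holds because a denotation is linear in the head subterm (`ap_wsum`,
`ifVec_wsum`, `sucVec_wsum`), the only place where weak reduction acts. Morphisms are compared
through their functions, on arbitrary families with values in `[0, ∞]`: the partial equivalence
relation `Eqv` replaces equality of matrices and is plain equality at the ground type, so it is
never needed that a matrix is determined by its function.

The one-step equation alone does not exclude that a coefficient exceeds the probability. The reverse
inequality uses the logical relation `Adeq` between families and closed terms. It contains zero, is
closed under increasing suprema (hence handles fixed points), under averaging over the one-step
reducts of a term (`Adeq.of_wsum`), and under evaluation contexts (`Adeq.evalCtx`). These closure
properties give the fundamental lemma `adeq_den_subst`, whose instance at the identity substitution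
is `natCoeff_le_iSup`. -/

theorem liftRen_comp {Γ Δ Θ : Ctx} {σ : Ty} (r : ∀ τ : Ty, Var Γ τ → Var Δ τ)
    (r' : ∀ τ : Ty, Var Δ τ → Var Θ τ) :
    (fun τ x => liftRen (σ := σ) r' τ (liftRen r τ x)) = liftRen fun τ x => r' τ (r τ x) := by
  funext τ x
  cases x <;> rfl

theorem Term.rename_rename {Γ : Ctx} {σ : Ty} (M : Term Γ σ) {Δ Θ : Ctx}
    (r : ∀ τ : Ty, Var Γ τ → Var Δ τ) (r' : ∀ τ : Ty, Var Δ τ → Var Θ τ) :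
    (M.rename r).rename r' = M.rename fun τ x => r' τ (r τ x) := by
  induction M generalizing Δ Θ <;> simp_all only [Term.rename, liftRen_comp]

theorem liftSub_liftRen {Γ Δ Θ : Ctx} {σ : Ty} (r : ∀ τ : Ty, Var Γ τ → Var Δ τ)
    (s : ∀ τ : Ty, Var Δ τ → Term Θ τ) :
    (fun τ x => liftSub (σ := σ) s τ (liftRen r τ x)) = liftSub fun τ x => s τ (r τ x) := by
  funext τ x
  cases x <;> rfl

theorem Term.subst_rename {Γ : Ctx} {σ : Ty} (M : Term Γ σ) {Δ Θ : Ctx}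
    (r : ∀ τ : Ty, Var Γ τ → Var Δ τ) (s : ∀ τ : Ty, Var Δ τ → Term Θ τ) :
    (M.rename r).subst s = M.subst fun τ x => s τ (r τ x) := by
  induction M generalizing Δ Θ <;> simp_all only [Term.rename, Term.subst, liftSub_liftRen]

theorem rename_liftSub {Γ Δ Θ : Ctx} {σ : Ty} (s : ∀ τ : Ty, Var Γ τ → Term Δ τ)
    (r : ∀ τ : Ty, Var Δ τ → Var Θ τ) :
    (fun τ x => (liftSub (σ := σ) s τ x).rename (liftRen r))
      = liftSub fun τ x => (s τ x).rename r := by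
  funext τ x
  cases x
  · rfl
  · simp only [liftSub, Term.rename_rename]
    rfl

theorem Term.rename_subst {Γ : Ctx} {σ : Ty} (M : Term Γ σ) {Δ Θ : Ctx}
    (s : ∀ τ : Ty, Var Γ τ → Term Δ τ) (r : ∀ τ : Ty, Var Δ τ → Var Θ τ) :
    (M.subst s).rename r = M.subst fun τ x => (s τ x).rename r := by
  induction M generalizing Δ Θ <;> simp_all only [Term.rename, Term.subst, rename_liftSub]

theorem subst_liftSub {Γ Δ Θ : Ctx} {σ : Ty} (s : ∀ τ : Ty, Var Γ τ → Term Δ τ)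
    (t : ∀ τ : Ty, Var Δ τ → Term Θ τ) :
    (fun τ x => (liftSub (σ := σ) s τ x).subst (liftSub t))
      = liftSub fun τ x => (s τ x).subst t := by
  funext τ x
  cases x
  · rfl
  · simp only [liftSub, Term.subst_rename, Term.rename_subst]

/-- Under a binder, `liftSub` weakens the substituted terms, so composition requires substitution to
commute with renaming on both sides; this is what the preceding mixed laws provide. -/
theorem Term.subst_subst {Γ : Ctx} {σ : Ty} (M : Term Γ σ) {Δ Θ : Ctx}
    (s : ∀ τ : Ty, Var Γ τ → Term Δ τ) (t : ∀ τ : Ty, Var Δ τ → Term Θ τ) :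
    (M.subst s).subst t = M.subst fun τ x => (s τ x).subst t := by
  induction M generalizing Δ Θ <;> simp_all only [Term.subst, subst_liftSub]

theorem liftSub_var {Γ : Ctx} {σ : Ty} :
    liftSub (σ := σ) (fun (τ : Ty) (x : Var Γ τ) => Term.var x) = fun _ x => Term.var x := by
  funext τ x
  cases x <;> rfl

theorem Term.subst_var {Γ : Ctx} {σ : Ty} (M : Term Γ σ) :
    M.subst (fun _ x => Term.var x) = M := by
  induction M <;> simp_all only [Term.subst, liftSub_var]

/-- The substitution that maps the last variable to `N`, and the other ones as `s` does. -/
def consSub {Γ Δ : Ctx} {σ : Ty} (s : ∀ τ : Ty, Var Γ τ → Term Δ τ) (N : Term Δ σ) :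
    ∀ τ : Ty, Var (σ :: Γ) τ → Term Δ τ
  | _, Var.zero => N
  | _, Var.suc x => s _ x

/-- Needed when a closing substitution has passed under a binder and the binder is then consumed by
a reduction: the two substitutions merge into a single simultaneous one. -/
theorem Term.subst_liftSub_inst {Γ Δ : Ctx} {σ τ : Ty} (M : Term (σ :: Γ) τ)
    (s : ∀ τ : Ty, Var Γ τ → Term Δ τ) (N : Term Δ σ) :
    (M.subst (liftSub s)).inst N = M.subst (consSub s N) := by
  rw [Term.inst, Term.subst_subst]
  congr 1
  funext τ x
  cases x
  · rfl
  · simp only [liftSub, Term.subst_rename, consSub]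
    exact Term.subst_var _

/-! ## Reduction in evaluation contexts -/

/-- The rules do not overlap: the head of a deterministic redex, when there is one, is an
abstraction or a numeral, in which no congruence rule can reduce. -/
theorem DRed.red_eq {Γ : Ctx} {σ : Ty} {M M' T : Term Γ σ} {p : ℝ} (h : DRed M M')
    (h' : Red M p T) : p = 1 ∧ T = M' := by
  cases h' with
  | det h' => cases h <;> cases h' <;> exact ⟨rfl, rfl⟩
  | coinZero => cases h
  | coinOne => cases h
  | app _ h' => cases h; cases h' with | det h' => cases h'
  | succ h' => cases h; cases h' with | det h' => cases h'
  | ifz _ _ h' => cases h <;> cases h' with | det h' => cases h'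

theorem weakNormal_num {Γ : Ctx} (n : ℕ) : WeakNormal (.num n : Term Γ Ty.nat) := by
  intro p M' h
  cases h with | det h => cases h

theorem weakNormal_lam {Γ : Ctx} {σ τ : Ty} (M : Term (σ :: Γ) τ) : WeakNormal (.lam M) := by
  intro p M' h
  cases h with | det h => cases h

theorem redMatrix_eq_zero {Γ : Ctx} {σ : Ty} {M T : Term Γ σ} (hM : ¬ WeakNormal M)
    (h : ∀ p, ¬ Red M p T) : redMatrix Γ σ M T = 0 := by
  rw [redMatrix, dif_neg (not_exists.2 h), if_neg fun h => hM h.1]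

open Classical in
theorem redMatrix_of_weakNormal {Γ : Ctx} {σ : Ty} {M : Term Γ σ} (hM : WeakNormal M)
    (T : Term Γ σ) : redMatrix Γ σ M T = if T = M then 1 else 0 := by
  rw [redMatrix, dif_neg (not_exists.2 fun p => hM p T)]
  simp [hM]

/-- Uniqueness of the probability removes the arbitrary choice made in the definition of the matrix.
-/
theorem redMatrix_eq {Γ : Ctx} {σ : Ty} {M T : Term Γ σ} {p : ℝ} (h : Red M p T)
    (hu : ∀ q, Red M q T → q = p) : redMatrix Γ σ M T = ENNReal.ofReal p := by
  have hex : ∃ p, Red M p T := ⟨p, h⟩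
  rw [redMatrix, dif_pos hex, hu _ hex.choose_spec]

theorem tsum_redMatrix_of_weakNormal {Γ : Ctx} {σ : Ty} {M : Term Γ σ} (hM : WeakNormal M)
    (f : Term Γ σ → ℝ≥0∞) : ∑' T, redMatrix Γ σ M T * f T = f M := by
  classical
  rw [tsum_eq_single M]
  · simp [redMatrix_of_weakNormal hM]
  · intro T hT
    simp [redMatrix_of_weakNormal hM, hT]

theorem tsum_redMatrix_of_dRed {Γ : Ctx} {σ : Ty} {M M' : Term Γ σ} (h : DRed M M')
    (f : Term Γ σ → ℝ≥0∞) : ∑' T, redMatrix Γ σ M T * f T = f M' := by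
  rw [tsum_eq_single M']
  · rw [redMatrix_eq (.det h) fun q hq => (h.red_eq hq).1]
    simp
  · intro T hT
    rw [redMatrix_eq_zero (fun hM => hM _ _ (.det h)) fun p hp => hT (h.red_eq hp).2, zero_mul]

/-- The two outcomes are distinct numerals, so each entry of the row receives a single probability
and nothing is lost or merged, even if `p` is `0` or `1`. -/
theorem tsum_redMatrix_coin {Γ : Ctx} (p : Set.Icc (0 : ℚ) 1) (f : Term Γ Ty.nat → ℝ≥0∞) :
    ∑' T, redMatrix Γ Ty.nat (.coin p) T * f T
      = ENNReal.ofReal ((p : ℚ) : ℝ) * f (.num 0)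
        + ENNReal.ofReal (1 - ((p : ℚ) : ℝ)) * f (.num 1) := by
  classical
  have hne : (.num 0 : Term Γ Ty.nat) ≠ .num 1 := by simp
  rw [tsum_eq_sum (s := {.num 0, .num 1}), Finset.sum_pair hne, redMatrix_eq (.coinZero p),
    redMatrix_eq (.coinOne p)]
  · intro q hq
    cases hq with
    | det h => cases h
    | coinOne => rfl
  · intro q hq
    cases hq with
    | det h => cases h
    | coinZero => rfl
  · intro T hT
    rw [redMatrix_eq_zero (fun hM => hM _ _ (.coinZero p)), zero_mul]
    intro q hq
    cases hq with
    | det h => cases h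
    | coinZero => simp at hT
    | coinOne => simp at hT

/-- Evaluation contexts: reduction takes place in the hole as long as the hole is not
weak-normal. -/
structure IsEvalCtx {Γ : Ctx} {σ τ : Ty} (E : Term Γ σ → Term Γ τ) : Prop where
  inj : Function.Injective E
  red : ∀ {M : Term Γ σ} {p : ℝ} {M' : Term Γ σ}, Red M p M' → Red (E M) p (E M')
  exists_red : ∀ {M : Term Γ σ} {p : ℝ} {T : Term Γ τ}, ¬ WeakNormal M → Red (E M) p T →
    ∃ M', T = E M' ∧ Red M p M'

theorem isEvalCtx_app {Γ : Ctx} {σ τ : Ty} (N : Term Γ σ) :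
    IsEvalCtx fun M : Term Γ (Ty.imp σ τ) => Term.app M N where
  inj M M' h := by simpa using h
  red h := .app N h
  exists_red hM h := by
    cases h with
    | det h => cases h; exact absurd (weakNormal_lam _) hM
    | app _ h => exact ⟨_, rfl, h⟩

theorem isEvalCtx_succ {Γ : Ctx} : IsEvalCtx fun M : Term Γ Ty.nat => Term.succ M where
  inj M M' h := by simpa using h
  red h := .succ h
  exists_red hM h := by
    cases h with
    | det h => cases h; exact absurd (weakNormal_num _) hM
    | succ h => exact ⟨_, rfl, h⟩

theorem isEvalCtx_ifz {Γ : Ctx} {σ : Ty} (P : Term Γ σ) (R : Term (Ty.nat :: Γ) σ) :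
    IsEvalCtx fun M : Term Γ Ty.nat => Term.ifz M P R where
  inj M M' h := by simpa using h
  red h := .ifz P R h
  exists_red hM h := by
    cases h with
    | det h => cases h <;> exact absurd (weakNormal_num _) hM
    | ifz _ _ h => exact ⟨_, rfl, h⟩

theorem IsEvalCtx.not_weakNormal {Γ : Ctx} {σ τ : Ty} {E : Term Γ σ → Term Γ τ}
    (hE : IsEvalCtx E) {M : Term Γ σ} (hM : ¬ WeakNormal M) : ¬ WeakNormal (E M) :=
  fun h => hM fun _ _ h' => h _ _ (hE.red h')

open Classical in
theorem IsEvalCtx.redMatrix_eq {Γ : Ctx} {σ τ : Ty} {E : Term Γ σ → Term Γ τ}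
    (hE : IsEvalCtx E) {M : Term Γ σ} (hM : ¬ WeakNormal M) (M' : Term Γ σ) :
    redMatrix Γ τ (E M) (E M') = redMatrix Γ σ M M' := by
  have h : (fun p => Red (E M) p (E M')) = fun p => Red M p M' := by
    funext p
    refine propext ⟨fun h => ?_, hE.red⟩
    obtain ⟨M'', e, h⟩ := hE.exists_red hM h
    exact hE.inj e ▸ h
  -- The chosen probability depends on the predicate; abstracting the predicate lets equal
  -- predicates yield the same choice.
  have key : ∀ (P Q : ℝ → Prop) (c : ℝ≥0∞), P = Q →
      (if h : ∃ p, P p then ENNReal.ofReal h.choose else c)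
        = if h : ∃ p, Q p then ENNReal.ofReal h.choose else c := by
    rintro P _ c rfl
    rfl
  simp only [redMatrix, hM, hE.not_weakNormal hM, false_and]
  exact key _ _ _ h

theorem IsEvalCtx.tsum_redMatrix {Γ : Ctx} {σ τ : Ty} {E : Term Γ σ → Term Γ τ}
    (hE : IsEvalCtx E) {M : Term Γ σ} (hM : ¬ WeakNormal M) (f : Term Γ τ → ℝ≥0∞) :
    ∑' T, redMatrix Γ τ (E M) T * f T = ∑' M', redMatrix Γ σ M M' * f (E M') := by
  rw [← hE.inj.tsum_eq]
  · exact tsum_congr fun M' => by rw [hE.redMatrix_eq hM]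
  · intro T hT
    by_contra hc
    refine hT ?_
    dsimp only
    rw [redMatrix_eq_zero (hE.not_weakNormal hM), zero_mul]
    intro p hp
    obtain ⟨M', e, -⟩ := hE.exists_red hM hp
    exact hc ⟨M', e.symm⟩

/-! ## Powers of the reduction matrix -/

/-- Powers are defined by adding a last step; every induction on reduction splits off the first step
instead. -/
theorem matPow_succ_left {I : Type} (S : I → I → ℝ≥0∞) (n : ℕ) (i j : I) :
    matPow S (n + 1) i j = ∑' k, S i k * matPow S n k j := by
  induction n generalizing j with
  | zero =>
    simp only [matPow]
    rw [tsum_eq_single i (by intro k hk; simp [hk.symm]),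
      tsum_eq_single j (by intro k hk; simp [hk])]
    simp
  | succ n ih =>
    rw [matPow]
    simp only [ih, ← ENNReal.tsum_mul_right]
    rw [ENNReal.tsum_comm]
    refine tsum_congr fun k => ?_
    simp only [matPow, ← ENNReal.tsum_mul_left, mul_assoc]

/-- Once the stationary state `j` is reached one may stay there: the term `k = j` of the sum
defining the next power is already the previous power. -/
theorem matPow_monotone {I : Type} {S : I → I → ℝ≥0∞} {j : I} (hj : S j j = 1) (i : I) :
    Monotone fun n => matPow S n i j := by
  refine monotone_nat_of_le_succ fun n => ?_
  have h := ENNReal.le_tsum (f := fun k => matPow S n i k * S k j) j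
  rwa [hj, mul_one] at h

/-- The probability that `M` reduces to the numeral `n` in at most `k` steps. -/
noncomputable def numProb (k : ℕ) (M : Term [] Ty.nat) (n : ℕ) : ℝ≥0∞ :=
  matPow (redMatrix [] Ty.nat) k M (.num n)

theorem redMatrix_num_self (n : ℕ) : redMatrix [] Ty.nat (.num n) (.num n) = 1 := by
  simp [redMatrix_of_weakNormal (weakNormal_num n)]

theorem numProb_succ (k : ℕ) (M : Term [] Ty.nat) (n : ℕ) :
    numProb (k + 1) M n = ∑' M', redMatrix [] Ty.nat M M' * numProb k M' n :=
  matPow_succ_left _ _ _ _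

theorem numProb_monotone (M : Term [] Ty.nat) (n : ℕ) : Monotone fun k => numProb k M n :=
  matPow_monotone (redMatrix_num_self n) M

theorem iSup_numProb (M : Term [] Ty.nat) (n : ℕ) :
    ⨆ k, numProb k M n = ∑' M', redMatrix [] Ty.nat M M' * ⨆ k, numProb k M' n := by
  simp only [ENNReal.mul_iSup]
  rw [tsum_iSup_of_monotone (fun k M' => redMatrix [] Ty.nat M M' * numProb k M' n)
    fun M' i j h => mul_le_mul_right (numProb_monotone M' n h) _]
  simp only [← numProb_succ]
  -- Dropping the first term of an increasing sequence leaves its supremum unchanged.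
  exact ((numProb_monotone M n).iSup_nat_add 1).symm

open Classical in
theorem numProb_num (k m n : ℕ) :
    numProb k (.num m) n = if n = m then 1 else 0 := by
  induction k with
  | zero => simp [numProb, matPow, eq_comm]
  | succ k ih => rw [numProb_succ, tsum_redMatrix_of_weakNormal (weakNormal_num m), ih]

/-! ## Denotations as functions -/

/-- Families of coefficients indexed by the web of a type. -/
abbrev Vec (σ : Ty) : Type := σ.sem.web → ℝ≥0∞

/-- Families of coefficients indexed by the web of a context. -/
abbrev Env (Γ : Ctx) : Type := (ctxSem Γ).web → ℝ≥0∞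

/-- The component of an environment at a variable. -/
def Env.get {Γ : Ctx} (u : Env Γ) {σ : Ty} (x : Var Γ σ) : Vec σ := fun a => u (x.inj a)

/-- Extension of an environment. -/
def Env.ext {Γ : Ctx} {σ : Ty} (u : Env Γ) (v : Vec σ) : Env (σ :: Γ) := Sum.elim u v

/-- Application at the level of families of coefficients. -/
noncomputable def ap {σ τ : Ty} (t : Vec (Ty.imp σ τ)) (u : Vec σ) : Vec τ :=
  fn (I := σ.sem.web) (J := τ.sem.web) t u

/-- The function associated with the interpretation of a term. -/
noncomputable def den {Γ : Ctx} {σ : Ty} (M : Term Γ σ) (u : Env Γ) : Vec σ :=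
  fn (I := (ctxSem Γ).web) (J := σ.sem.web) M.sem.1 u

/-- Linear combinations of families of coefficients. -/
noncomputable def wsum {ι : Type} {σ : Ty} (c : ι → ℝ≥0∞) (t : ι → Vec σ) : Vec σ :=
  fun b => ∑' i, c i * t i b

/-- The denotation of a conditional. -/
noncomputable def ifVec {σ : Ty} (s : ℕ → ℝ≥0∞) (t : Vec σ) (r : ℕ → Vec σ) : Vec σ :=
  wsum s fun n => Nat.casesOn n t r

theorem den_num {Γ : Ctx} (n : ℕ) (u : Env Γ) : den (.num n) u = numVec n :=
  fn_constMat (I := (ctxSem Γ).web) (numVec n) u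

theorem den_coin {Γ : Ctx} (p : Set.Icc (0 : ℚ) 1) (u : Env Γ) : den (.coin p) u = coinVec p :=
  fn_constMat (I := (ctxSem Γ).web) (coinVec p) u

theorem den_var {Γ : Ctx} {σ : Ty} (x : Var Γ σ) (u : Env Γ) : den (.var x) u = u.get x :=
  fn_projMat (J := σ.sem.web) x.inj u

theorem den_succ {Γ : Ctx} (M : Term Γ Ty.nat) (u : Env Γ) :
    den (.succ M) u = sucVec (den M u) :=
  fn_sucMat (I := (ctxSem Γ).web) M.sem.1 u

theorem den_ifz {Γ : Ctx} {σ : Ty} (M : Term Γ Ty.nat) (P : Term Γ σ)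
    (R : Term (Ty.nat :: Γ) σ) (u : Env Γ) :
    den (.ifz M P R) u
      = ifVec (den M u) (den P u) fun n => den R (u.ext (σ := Ty.nat) (numVec n)) := by
  refine (fn_ifMat (I := (ctxSem Γ).web) (K := σ.sem.web) M.sem.1 P.sem.1 R.sem.1 u).trans ?_
  funext b
  exact (tsum_eq_zero_add' (f := fun i => den M u i * (Nat.casesOn i (den P u)
    fun n => den R (u.ext (σ := Ty.nat) (numVec n)) : Vec σ) b) ENNReal.summable).symm

theorem den_lam {Γ : Ctx} {σ τ : Ty} (M : Term (σ :: Γ) τ) (u : Env Γ) (v : Vec σ) :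
    ap (den (.lam M) u) v = den M (u.ext v) :=
  fn_curMat (I := (ctxSem Γ).web) (J := σ.sem.web) (K := τ.sem.web) M.sem.1 u v

theorem den_app {Γ : Ctx} {σ τ : Ty} (M : Term Γ (Ty.imp σ τ)) (N : Term Γ σ) (u : Env Γ) :
    den (.app M N) u = ap (den M u) (den N u) :=
  fn_appMat (I := (ctxSem Γ).web) (J := σ.sem.web) (K := τ.sem.web) M.sem.1 N.sem.1 u

theorem den_fix {Γ : Ctx} {σ : Ty} (M : Term Γ (Ty.imp σ σ)) (u : Env Γ) :
    den (.fix M) u = fun b => ⨆ n : ℕ, (ap (den M u))^[n] (fun _ => 0) b :=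
  fn_fixMat (I := (ctxSem Γ).web) (J := σ.sem.web) M.sem.1 u

theorem ap_iSup {σ τ : Ty} (t : ℕ → Vec (Ty.imp σ τ)) (ht : Monotone t) (u : Vec σ) :
    ap (fun p => ⨆ n, t n p) u = fun b => ⨆ n, ap (t n) u b := by
  funext b
  change ∑' m, (⨆ n, t n (m, b)) * promVec u m = ⨆ n, ∑' m, t n (m, b) * promVec u m
  simp only [ENNReal.iSup_mul]
  exact tsum_iSup_of_monotone _ fun m i j h => mul_le_mul_left (ht h _) _

/-- Application is linear in the function, though not in the argument. This is why averaging over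
the reducts of a term in function position commutes with applying it; the weights need no bound. -/
theorem ap_wsum {ι : Type} {σ τ : Ty} (c : ι → ℝ≥0∞) (t : ι → Vec (Ty.imp σ τ)) (u : Vec σ) :
    ap (wsum c t) u = wsum c fun i => ap (t i) u := by
  funext b
  change ∑' m, (∑' i, c i * t i (m, b)) * promVec u m
    = ∑' i, c i * ∑' m, t i (m, b) * promVec u m
  simp only [← ENNReal.tsum_mul_right, ← ENNReal.tsum_mul_left, mul_assoc]
  exact ENNReal.tsum_comm

theorem ap_zero {σ τ : Ty} (u : Vec σ) :
    ap (fun _ => 0 : Vec (Ty.imp σ τ)) u = fun _ => 0 := by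
  funext b
  change ∑' m, 0 * promVec u m = 0
  simp

theorem promVec_mono {I : Type} {u v : I → ℝ≥0∞} (h : u ≤ v) (m : Multiset I) :
    promVec u m ≤ promVec v m := by
  induction m using Multiset.induction with
  | empty => simp [promVec]
  | cons a m ih =>
    rw [promVec_cons, promVec_cons]
    exact mul_le_mul' (h a) ih

theorem ap_mono {σ τ : Ty} {s t : Vec (Ty.imp σ τ)} {u v : Vec σ} (h : s ≤ t) (h' : u ≤ v) :
    ap s u ≤ ap t v :=
  fun _ => ENNReal.tsum_le_tsum fun m => mul_le_mul' (h _) (promVec_mono h' m)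

theorem iterate_ap_monotone {σ : Ty} (t : Vec (Ty.imp σ σ)) :
    Monotone fun n => (ap t)^[n] fun _ => 0 :=
  Monotone.monotone_iterate_of_le_map (fun _ _ h => ap_mono le_rfl h) fun _ => zero_le

theorem wsum_wsum {ι κ : Type} {σ : Ty} (c : ι → ℝ≥0∞) (d : ι → κ → ℝ≥0∞) (t : κ → Vec σ) :
    wsum c (fun i => wsum (d i) t) = wsum (fun k => ∑' i, c i * d i k) t := by
  funext b
  simp only [wsum, ← ENNReal.tsum_mul_right, ← ENNReal.tsum_mul_left, mul_assoc]
  exact ENNReal.tsum_comm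

theorem ifVec_wsum {ι : Type} {σ : Ty} (c : ι → ℝ≥0∞) (s : ι → Vec Ty.nat) (t : Vec σ)
    (r : ℕ → Vec σ) : ifVec (wsum c s) t r = wsum c fun i => ifVec (s i) t r :=
  (wsum_wsum c s _).symm

/-- Puts the successor in the same form as the conditional, a sum weighted by the scrutinee, so that
linearity and `Adeq.evalCtx` apply to both. -/
theorem sucVec_eq_wsum (u : ℕ → ℝ≥0∞) :
    sucVec u = wsum (σ := Ty.nat) u fun n => numVec (n + 1) := by
  classical
  funext k
  change _ = ∑' n, u n * numVec (n + 1) k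
  cases k with
  | zero => simp [numVec, sucVec]
  | succ k =>
    rw [tsum_eq_single k]
    · simp [numVec, sucVec]
    · intro n hn
      simp [numVec, hn.symm]

theorem den_succ_eq_wsum {Γ : Ctx} (M : Term Γ Ty.nat) (u : Env Γ) :
    den (.succ M) u = wsum (σ := Ty.nat) (den M u) fun n : ℕ => numVec (n + 1) :=
  (den_succ M u).trans (sucVec_eq_wsum _)

theorem sucVec_wsum {ι : Type} (c : ι → ℝ≥0∞) (s : ι → Vec Ty.nat) :
    sucVec (wsum c s) = wsum (σ := Ty.nat) c fun i => sucVec (s i) := by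
  refine (sucVec_eq_wsum _).trans ((wsum_wsum c s _).symm.trans ?_)
  exact congrArg (wsum c) (funext fun i => (sucVec_eq_wsum _).symm)

theorem wsum_numVec_left {σ : Ty} (n : ℕ) (t : ℕ → Vec σ) : wsum (numVec n) t = t n := by
  classical
  funext b
  rw [wsum, tsum_eq_single n]
  · simp [numVec]
  · intro k hk
    simp [numVec, hk]

theorem wsum_redMatrix_of_dRed {Γ : Ctx} {σ τ : Ty} {M M' : Term Γ σ} (h : DRed M M')
    (f : Term Γ σ → Vec τ) : wsum (redMatrix Γ σ M) f = f M' :=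
  funext fun b => tsum_redMatrix_of_dRed h fun T => f T b

theorem IsEvalCtx.wsum_redMatrix {Γ : Ctx} {σ τ τ' : Ty} {E : Term Γ σ → Term Γ τ}
    (hE : IsEvalCtx E) {M : Term Γ σ} (hM : ¬ WeakNormal M) (f : Term Γ τ → Vec τ') :
    wsum (redMatrix Γ τ (E M)) f = wsum (redMatrix Γ σ M) fun M' => f (E M') :=
  funext fun b => hE.tsum_redMatrix hM fun T => f T b

theorem wsum_redMatrix_coin {Γ : Ctx} (p : Set.Icc (0 : ℚ) 1) (u : Env Γ) :
    wsum (redMatrix Γ Ty.nat (.coin p)) (fun T => den T u) = coinVec p := by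
  funext b
  refine (tsum_redMatrix_coin p fun T => den T u b).trans ?_
  simp only [den_num]
  rfl

/-! ## Extensional equality of families of coefficients -/

/-- Equality at the ground type, and preservation of extensional equality at function types. -/
def Eqv : (σ : Ty) → Vec σ → Vec σ → Prop
  | .nat => fun u v => u = v
  | .imp σ τ => fun s t => ∀ u v : Vec σ, Eqv σ u v → Eqv τ (ap s u) (ap t v)

theorem Eqv.symm : {σ : Ty} → {u v : Vec σ} → Eqv σ u v → Eqv σ v u
  | .nat, _, _, h => Eq.symm h
  | .imp _ _, _, _, h => fun u v huv => (h v u huv.symm).symm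

/-- `Eqv` need not be reflexive. At function types the middle step needs `v` to be related to
itself, which symmetry and transitivity at the smaller type extract from `huv`. -/
theorem Eqv.trans : {σ : Ty} → {u v w : Vec σ} → Eqv σ u v → Eqv σ v w → Eqv σ u w
  | .nat, _, _, _, h, h' => Eq.trans h h'
  | .imp _ _, _, _, _, h, h' => fun u v huv => (h u v huv).trans (h' v v (huv.symm.trans huv))

theorem Eqv.zero : {σ : Ty} → Eqv σ (fun _ => 0) (fun _ => 0)
  | .nat => Eq.refl _
  | .imp _ _ => fun u v _ => by
    rw [ap_zero, ap_zero]
    exact Eqv.zero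

theorem Eqv.wsum {ι : Type} (c : ι → ℝ≥0∞) : {σ : Ty} → {s t : ι → Vec σ} →
    (∀ i, Eqv σ (s i) (t i)) → Eqv σ (wsum c s) (wsum c t)
  | .nat, s, t, h => by
    have : s = t := funext h
    rw [this]
    exact Eq.refl _
  | .imp _ _, _, _, h => fun u v huv => by
    rw [ap_wsum, ap_wsum]
    exact Eqv.wsum c fun i => h i u v huv

theorem Eqv.iSup : {σ : Ty} → {s t : ℕ → Vec σ} → Monotone s → Monotone t →
    (∀ n, Eqv σ (s n) (t n)) → Eqv σ (fun b => ⨆ n, s n b) (fun b => ⨆ n, t n b)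
  | .nat, s, t, _, _, h => by
    have : s = t := funext h
    rw [this]
    exact Eq.refl _
  | .imp _ _, s, t, hs, ht, h => fun u v huv => by
    rw [ap_iSup s hs, ap_iSup t ht]
    exact Eqv.iSup (fun _ _ hij => ap_mono (hs hij) le_rfl)
      (fun _ _ hij => ap_mono (ht hij) le_rfl) fun n => h n u v huv

theorem Eqv.ifVec {σ : Ty} {s s' : Vec Ty.nat} {t t' : Vec σ} {r r' : ℕ → Vec σ}
    (hs : Eqv Ty.nat s s') (ht : Eqv σ t t') (hr : ∀ n, Eqv σ (r n) (r' n)) :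
    Eqv σ (ifVec s t r) (ifVec s' t' r') := by
  obtain rfl : s = s' := hs
  refine Eqv.wsum _ fun n => ?_
  cases n
  · exact ht
  · exact hr _

/-- The finite approximants are related one by one, starting from zero, and `Eqv` passes to
increasing suprema. -/
theorem Eqv.fix {σ : Ty} {s t : Vec (Ty.imp σ σ)} (h : Eqv (Ty.imp σ σ) s t) :
    Eqv σ (fun b => ⨆ n : ℕ, (ap s)^[n] (fun _ => 0) b)
      (fun b => ⨆ n : ℕ, (ap t)^[n] (fun _ => 0) b) := by
  refine Eqv.iSup (iterate_ap_monotone s) (iterate_ap_monotone t) fun n => ?_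
  induction n with
  | zero => exact Eqv.zero
  | succ n ih =>
    rw [Function.iterate_succ_apply', Function.iterate_succ_apply']
    exact h _ _ ih

theorem eqv_den_rename {Γ Δ : Ctx} {σ : Ty} (M : Term Γ σ) (r : ∀ τ : Ty, Var Γ τ → Var Δ τ)
    (u : Env Δ) (v : Env Γ) (h : ∀ τ (x : Var Γ τ), Eqv τ (u.get (r τ x)) (v.get x)) :
    Eqv σ (den (M.rename r) u) (den M v) := by
  have hext : ∀ {Γ Δ : Ctx} {σ : Ty} {r : ∀ τ : Ty, Var Γ τ → Var Δ τ} {u : Env Δ} {v : Env Γ}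
      {a b : Vec σ}, (∀ τ (x : Var Γ τ), Eqv τ (u.get (r τ x)) (v.get x)) → Eqv σ a b →
      ∀ τ (x : Var (σ :: Γ) τ), Eqv τ ((u.ext a).get (liftRen r τ x)) ((v.ext b).get x) := by
    intro Γ Δ σ r u v a b h hab τ x
    cases x with
    | zero => exact hab
    | suc x => exact h _ x
  induction M generalizing Δ with
  | num n => simp only [Term.rename, den_num]; exact Eq.refl _
  | coin p => simp only [Term.rename, den_coin]; exact Eq.refl _
  | var x => simp only [Term.rename, den_var]; exact h _ x
  | succ M ih =>
    simp only [Term.rename, den_succ]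
    exact congrArg sucVec (ih r u v h)
  | ifz M P R ihM ihP ihR =>
    simp only [Term.rename, den_ifz]
    exact (ihM r u v h).ifVec (ihP r u v h) fun n => ihR _ _ _ (hext h (Eq.refl _))
  | lam M ih =>
    intro a b hab
    simp only [Term.rename, den_lam]
    exact ih _ _ _ (hext h hab)
  | app M N ihM ihN =>
    simp only [Term.rename, den_app]
    exact ihM r u v h _ _ (ihN r u v h)
  | fix M ih =>
    simp only [Term.rename, den_fix]
    exact (ih r u v h).fix

/-- The hypothesis `hu` serves under binders: comparing a weakened term of `liftSub` with the
original one goes through `eqv_den_rename`, which requires the environment to be related to itself.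
-/
theorem eqv_den_subst {Γ Δ : Ctx} {σ : Ty} (M : Term Γ σ) (s : ∀ τ : Ty, Var Γ τ → Term Δ τ)
    (u : Env Δ) (v : Env Γ) (hu : ∀ τ (x : Var Δ τ), Eqv τ (u.get x) (u.get x))
    (h : ∀ τ (x : Var Γ τ), Eqv τ (den (s τ x) u) (v.get x)) :
    Eqv σ (den (M.subst s) u) (den M v) := by
  have hself : ∀ {Δ : Ctx} {σ : Ty} {u : Env Δ} {a b : Vec σ},
      (∀ τ (x : Var Δ τ), Eqv τ (u.get x) (u.get x)) → Eqv σ a b →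
      ∀ τ (x : Var (σ :: Δ) τ), Eqv τ ((u.ext a).get x) ((u.ext a).get x) := by
    intro Δ σ u a b hu hab τ x
    cases x with
    | zero => exact hab.trans hab.symm
    | suc x => exact hu _ x
  have hext : ∀ {Γ Δ : Ctx} {σ : Ty} {s : ∀ τ : Ty, Var Γ τ → Term Δ τ} {u : Env Δ} {v : Env Γ}
      {a b : Vec σ}, (∀ τ (x : Var Δ τ), Eqv τ (u.get x) (u.get x)) →
      (∀ τ (x : Var Γ τ), Eqv τ (den (s τ x) u) (v.get x)) → Eqv σ a b →
      ∀ τ (x : Var (σ :: Γ) τ), Eqv τ (den (liftSub s τ x) (u.ext a)) ((v.ext b).get x) := by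
    intro Γ Δ σ s u v a b hu h hab τ x
    cases x with
    | zero => simp only [liftSub, den_var]; exact hab
    | suc x => exact (eqv_den_rename (s _ x) (fun _ => Var.suc) (u.ext a) u hu).trans (h _ x)
  induction M generalizing Δ with
  | num n => simp only [Term.subst, den_num]; exact Eq.refl _
  | coin p => simp only [Term.subst, den_coin]; exact Eq.refl _
  | var x => simp only [Term.subst, den_var]; exact h _ x
  | succ M ih =>
    simp only [Term.subst, den_succ]
    exact congrArg sucVec (ih s u v hu h)
  | ifz M P R ihM ihP ihR =>
    simp only [Term.subst, den_ifz]
    exact (ihM s u v hu h).ifVec (ihP s u v hu h) fun n =>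
      ihR _ _ _ (hself hu (b := numVec n) (Eq.refl _)) (hext hu h (Eq.refl _))
  | lam M ih =>
    intro a b hab
    simp only [Term.subst, den_lam]
    exact ih _ _ _ (hself hu hab) (hext hu h hab)
  | app M N ihM ihN =>
    simp only [Term.subst, den_app]
    exact ihM s u v hu h _ _ (ihN s u v hu h)
  | fix M ih =>
    simp only [Term.subst, den_fix]
    exact (ih s u v hu h).fix

/-- Reflexivity on denotations, obtained from the substitution lemma at the identity substitution.
-/
theorem eqv_den_self {Γ : Ctx} {σ : Ty} (M : Term Γ σ) (u : Env Γ)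
    (hu : ∀ τ (x : Var Γ τ), Eqv τ (u.get x) (u.get x)) : Eqv σ (den M u) (den M u) := by
  have h := eqv_den_subst M (fun _ x => .var x) u u hu fun τ x => by
    rw [den_var]
    exact hu τ x
  rwa [Term.subst_var] at h

theorem eqv_den_inst {Γ : Ctx} {σ τ : Ty} (M : Term (σ :: Γ) τ) (N : Term Γ σ) (u : Env Γ)
    (hu : ∀ τ (x : Var Γ τ), Eqv τ (u.get x) (u.get x)) :
    Eqv τ (den (M.inst N) u) (den M (u.ext (den N u))) := by
  refine eqv_den_subst M _ _ _ hu fun τ x => ?_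
  cases x with
  | zero => exact eqv_den_self N u hu
  | suc x =>
    simp only [singleSub, den_var]
    exact hu _ x

/-! ## Invariance of the interpretation under reduction -/

theorem promVec_iSup {I : Type} (u : ℕ → I → ℝ≥0∞) (hu : Monotone u) (m : Multiset I) :
    promVec (fun a => ⨆ n, u n a) m = ⨆ n, promVec (u n) m := by
  induction m using Multiset.induction with
  | empty => simp [promVec]
  | cons a m ih =>
    simp only [promVec_cons]
    rw [ih]
    refine le_antisymm ?_ (iSup_le fun n => mul_le_mul' (le_iSup (u · a) n)
      (le_iSup (fun n => promVec (u n) m) n))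
    simp only [ENNReal.iSup_mul, ENNReal.mul_iSup]
    refine iSup_le fun i => iSup_le fun j => ?_
    -- The two independent indices are merged: by monotonicity both factors are bounded by their
    -- values at the maximum.
    exact le_iSup_of_le (max i j)
      (mul_le_mul' (hu (le_max_right i j) a) (promVec_mono (hu (le_max_left i j)) m))

theorem fn_iSup {I J : Type} (t : Multiset I × J → ℝ≥0∞) (u : ℕ → I → ℝ≥0∞) (hu : Monotone u) :
    fn t (fun a => ⨆ n, u n a) = fun b => ⨆ n, fn t (u n) b := by
  funext b
  simp only [fn, matApp, promVec_iSup u hu, ENNReal.mul_iSup]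
  exact tsum_iSup_of_monotone _ fun m i j h => mul_le_mul_right (promVec_mono (hu h) _) _

theorem ap_iSup_right {σ τ : Ty} (t : Vec (Ty.imp σ τ)) (u : ℕ → Vec σ) (hu : Monotone u) :
    ap t (fun a => ⨆ n, u n a) = fun b => ⨆ n, ap t (u n) b :=
  fn_iSup (I := σ.sem.web) (J := τ.sem.web) t u hu

/-- Continuity of application in its argument turns the right-hand side into the supremum of the
shifted iterates, which is the same supremum. -/
theorem den_fix_eq_ap {Γ : Ctx} {σ : Ty} (M : Term Γ (Ty.imp σ σ)) (u : Env Γ) :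
    den (.fix M) u = den (.app M (.fix M)) u := by
  rw [den_app, den_fix, ap_iSup_right _ _ (iterate_ap_monotone _)]
  funext b
  simp only [← Function.iterate_succ_apply' (ap (den M u))]
  exact (Monotone.iSup_nat_add (f := fun n => (ap (den M u))^[n] (fun _ => 0) b)
    (fun _ _ h => iterate_ap_monotone _ h b) 1).symm

theorem eqv_den_of_dRed {Γ : Ctx} {σ : Ty} {M M' : Term Γ σ} (h : DRed M M') (u : Env Γ)
    (hu : ∀ τ (x : Var Γ τ), Eqv τ (u.get x) (u.get x)) : Eqv σ (den M u) (den M' u) := by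
  cases h with
  | beta M N =>
    rw [den_app, den_lam]
    exact (eqv_den_inst M N u hu).symm
  | fix M =>
    rw [den_fix_eq_ap]
    exact eqv_den_self _ u hu
  | succ n =>
    rw [den_succ_eq_wsum, den_num, den_num]
    exact wsum_numVec_left n _
  | ifzZero P R =>
    rw [den_ifz, den_num, ifVec, wsum_numVec_left]
    exact eqv_den_self _ u hu
  | ifzSucc n P R =>
    rw [den_ifz, den_num, ifVec, wsum_numVec_left]
    have h := eqv_den_inst R (.num n) u hu
    rw [den_num] at h
    exact h.symm

/-- The given reduction serves to locate the redex: the induction descends along its derivation, and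
the conclusion averages over all the reducts of `M`. Each congruence case moves the average out of
the head position by linearity. -/
theorem eqv_den_wsum {Γ : Ctx} {σ : Ty} {M M' : Term Γ σ} {p : ℝ} (h : Red M p M') (u : Env Γ)
    (hu : ∀ τ (x : Var Γ τ), Eqv τ (u.get x) (u.get x)) :
    Eqv σ (den M u) (wsum (redMatrix Γ σ M) fun T => den T u) := by
  induction h with
  | det h =>
    rw [wsum_redMatrix_of_dRed h]
    exact eqv_den_of_dRed h u hu
  | coinZero p => rw [wsum_redMatrix_coin, den_coin]; exact Eq.refl _
  | coinOne p => rw [wsum_redMatrix_coin, den_coin]; exact Eq.refl _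
  | app N h ih =>
    rw [(isEvalCtx_app N).wsum_redMatrix fun hM => hM _ _ h]
    simp only [den_app]
    rw [← ap_wsum]
    exact ih _ _ (eqv_den_self N u hu)
  | succ h ih =>
    rw [isEvalCtx_succ.wsum_redMatrix fun hM => hM _ _ h]
    simp only [den_succ]
    exact (congrArg sucVec ih).trans (sucVec_wsum _ _)
  | ifz P R h ih =>
    rw [(isEvalCtx_ifz P R).wsum_redMatrix fun hM => hM _ _ h]
    simp only [den_ifz]
    rw [← ifVec_wsum]
    exact ih.ifVec (eqv_den_self P u hu) fun n => eqv_den_self R _ fun τ x => by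
      cases x with
      | zero => exact Eq.refl (numVec n)
      | suc x => exact hu _ x

/-- The only environment for the empty context. -/
def emptyEnv : Env [] := Empty.elim

theorem fn_empty {J : Type} (s : Multiset Empty × J → ℝ≥0∞) (u : Empty → ℝ≥0∞) (b : J) :
    fn s u b = s (0, b) := by
  rw [fn, matApp, tsum_eq_single 0 fun m hm => absurd (Subsingleton.elim m 0) hm, promVec_zero,
    mul_one]

theorem den_emptyEnv (M : Term [] Ty.nat) (n : ℕ) :
    (den M emptyEnv : ℕ → ℝ≥0∞) n = M.natCoeff n :=
  fn_empty M.sem.1 emptyEnv n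

theorem tsum_redMatrix_natCoeff (M : Term [] Ty.nat) (n : ℕ) :
    ∑' M', redMatrix [] Ty.nat M M' * M'.natCoeff n = M.natCoeff n := by
  by_cases hM : WeakNormal M
  · exact tsum_redMatrix_of_weakNormal hM _
  · simp only [WeakNormal, not_forall, not_not] at hM
    obtain ⟨p, M', h⟩ := hM
    -- At the ground type `Eqv` unfolds to equality of families.
    have e : den M emptyEnv = _ := eqv_den_wsum h emptyEnv fun τ x => nomatch x
    rw [← den_emptyEnv, e]
    simp only [← den_emptyEnv]
    rfl

theorem numProb_le_natCoeff (k : ℕ) (M : Term [] Ty.nat) (n : ℕ) :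
    numProb k M n ≤ M.natCoeff n := by
  induction k generalizing M with
  | zero =>
    by_cases h : M = .num n
    · subst h
      rw [numProb_num, if_pos rfl, ← den_emptyEnv, den_num]
      simp [numVec]
    · simp [numProb, matPow, h]
  | succ k ih =>
    -- Both sides become averages over the same first step, so the induction hypothesis compares
    -- them term by term.
    rw [numProb_succ, ← tsum_redMatrix_natCoeff]
    exact ENNReal.tsum_le_tsum fun M' => mul_le_mul_right (ih M') _

/-! ## Adequacy -/

/-- The logical relation between families of coefficients and closed terms. -/
def Adeq : (σ : Ty) → Vec σ → Term [] σ → Prop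
  | .nat => fun u M => ∀ n : ℕ, u n ≤ ⨆ k, numProb k M n
  | .imp σ τ => fun t M => ∀ (u : Vec σ) (N : Term [] σ), Adeq σ u N →
      Adeq τ (ap t u) (.app M N)

theorem Adeq.mono : {σ : Ty} → {u v : Vec σ} → {M : Term [] σ} → u ≤ v → Adeq σ v M →
    Adeq σ u M
  | .nat, _, _, _, h, hv => fun n => (h n).trans (hv n)
  | .imp _ _, _, _, _, h, hv => fun u N hu => (hv u N hu).mono (ap_mono h le_rfl)

theorem Adeq.zero : {σ : Ty} → {M : Term [] σ} → Adeq σ (fun _ => 0) M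
  | .nat, _ => fun _ => zero_le
  | .imp _ _, _ => fun u N _ => by
    rw [ap_zero]
    exact Adeq.zero

theorem Adeq.iSup : {σ : Ty} → {u : ℕ → Vec σ} → {M : Term [] σ} → Monotone u →
    (∀ n, Adeq σ (u n) M) → Adeq σ (fun b => ⨆ n, u n b) M
  | .nat, _, _, _, h => fun n => iSup_le fun i => h i n
  | .imp _ _, t, _, ht, h => fun u N hu => by
    rw [ap_iSup t ht]
    exact Adeq.iSup (fun _ _ hij => ap_mono (ht hij) le_rfl) fun n => h n u N hu

/-- `Adeq.of_wsum` expects a family indexed by all terms of type `τ`, while only those in the image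
of `E` are reachable. Elsewhere the value zero is used, as it is adequate for every term. -/
theorem exists_adeq_extension {σ τ : Ty} {E : Term [] σ → Term [] τ} (hE : IsEvalCtx E)
    {u : Term [] σ → Vec τ} (h : ∀ M, Adeq τ (u M) (E M)) :
    ∃ f : Term [] τ → Vec τ, (∀ M, f (E M) = u M) ∧ ∀ T, Adeq τ (f T) T := by
  refine ⟨Function.extend E u fun _ _ => 0, hE.inj.extend_apply _ _, fun T => ?_⟩
  by_cases hT : ∃ M, E M = T
  · obtain ⟨M, rfl⟩ := hT
    rw [hE.inj.extend_apply]
    exact h M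
  · rw [Function.extend_apply' _ _ _ hT]
    exact Adeq.zero

/-- At the ground type this is the one-step equation for probabilities. At function types, applying
to `N` gives an evaluation context: since `M` is not weak-normal, the reducts of the application are
those of `M` applied to `N`, with the same probabilities, and linearity in the function reduces to
the result type. -/
theorem Adeq.of_wsum : {σ : Ty} → {M : Term [] σ} → {u : Term [] σ → Vec σ} →
    ¬ WeakNormal M → (∀ M', Adeq σ (u M') M') → Adeq σ (wsum (redMatrix [] σ M) u) M
  | .nat, M, u, _, h => fun n => by
    rw [iSup_numProb]
    exact ENNReal.tsum_le_tsum fun M' => mul_le_mul_right (h M' n) _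
  | .imp σ τ, M, u, hM, h => fun v N hv => by
    have hE := isEvalCtx_app (τ := τ) N
    obtain ⟨f, hf, hf'⟩ := exists_adeq_extension hE fun M' => h M' v N hv
    have key := Adeq.of_wsum (hE.not_weakNormal hM) hf'
    rw [hE.wsum_redMatrix hM] at key
    simp only [hf] at key
    rwa [ap_wsum]

theorem Adeq.of_wsum_evalCtx {σ τ : Ty} {E : Term [] σ → Term [] τ} (hE : IsEvalCtx E)
    {M : Term [] σ} {u : Term [] σ → Vec τ} (hM : ¬ WeakNormal M)
    (h : ∀ M', Adeq τ (u M') (E M')) : Adeq τ (wsum (redMatrix [] σ M) u) (E M) := by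
  obtain ⟨f, hf, hf'⟩ := exists_adeq_extension hE h
  have key := Adeq.of_wsum (hE.not_weakNormal hM) hf'
  rw [hE.wsum_redMatrix hM] at key
  simpa only [hf] using key

theorem Adeq.of_dRed {σ : Ty} {M M' : Term [] σ} {u : Vec σ} (h : DRed M M')
    (hu : Adeq σ u M') : Adeq σ u M := by
  classical
  -- The only reduct carrying weight is `M'`; zero is a harmless value at all other terms.
  have key := Adeq.of_wsum (M := M) (u := fun T => if T = M' then u else fun _ => 0)
    (fun hM => hM _ _ (.det h)) fun T => by
      split_ifs with hT
      · exact hT ▸ hu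
      · exact Adeq.zero
  rwa [wsum_redMatrix_of_dRed h, if_pos rfl] at key

/-- An evaluation context preserves adequacy as soon as it does so for numerals. -/
theorem Adeq.evalCtx {σ : Ty} {E : Term [] Ty.nat → Term [] σ} (hE : IsEvalCtx E)
    {v : ℕ → Vec σ} (hv : ∀ n, Adeq σ (v n) (E (.num n))) {u : Vec Ty.nat} {M : Term [] Ty.nat}
    (hu : Adeq Ty.nat u M) : Adeq σ (wsum u v) (E M) := by
  -- Adequacy of `u` only bounds it by limit probabilities, so the weights are first replaced by the
  -- probabilities within `k` steps, for all terms at once.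
  have key : ∀ k M, Adeq σ (wsum (numProb k M) v) (E M) := by
    intro k
    induction k with
    | zero =>
      intro M
      by_cases h : ∃ m, M = .num m
      · obtain ⟨m, rfl⟩ := h
        have e : numProb 0 (.num m) = numVec m := funext fun n => numProb_num 0 m n
        rw [e, wsum_numVec_left]
        exact hv m
      · have e : wsum (numProb 0 M) v = fun _ => 0 := by
          have h0 : ∀ n, numProb 0 M n = 0 := fun n => if_neg fun e => h ⟨n, e⟩
          funext b
          simp [wsum, h0]
        rw [e]
        exact Adeq.zero
    | succ k ih =>
      intro M
      have e : numProb (k + 1) M = fun n => ∑' M', redMatrix [] Ty.nat M M' * numProb k M' n :=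
        funext fun n => numProb_succ k M n
      -- A weak-normal term need not be known to be a numeral: its row of the matrix is the identity
      -- row, so one more step changes nothing.
      by_cases hM : WeakNormal M
      · simp only [tsum_redMatrix_of_weakNormal hM] at e
        rw [e]
        exact ih M
      · rw [e, ← wsum_wsum]
        exact Adeq.of_wsum_evalCtx hE hM ih
  -- Monotone convergence: `wsum u v` lies below the supremum over `k` of the sums weighted by the
  -- `k`-step probabilities.
  refine Adeq.mono ?_ (Adeq.iSup (u := fun k => wsum (numProb k M) v) ?_ fun k => key k M)
  · intro b
    dsimp only [wsum]
    rw [← tsum_iSup_of_monotone (fun k n => numProb k M n * v n b)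
      fun n i j h => mul_le_mul_left (numProb_monotone M n h) _]
    simp only [← ENNReal.iSup_mul]
    exact ENNReal.tsum_le_tsum fun n => mul_le_mul_left (hu n) _
  · exact fun i j h b => ENNReal.tsum_le_tsum fun n =>
      mul_le_mul_left (numProb_monotone M n h) _

theorem adeq_num (n : ℕ) : Adeq Ty.nat (numVec n) (.num n) := fun m =>
  (numProb_num 0 n m).symm.le.trans (le_iSup (fun k => numProb k (.num n) m) 0)

/-- The fundamental lemma of the logical relation. Binders are the reason for an arbitrary
environment and closing substitution: contracting a redex extends both by a related pair. -/
theorem adeq_den_subst {Γ : Ctx} {σ : Ty} (M : Term Γ σ) (v : Env Γ)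
    (s : ∀ τ : Ty, Var Γ τ → Term [] τ) (h : ∀ τ (x : Var Γ τ), Adeq τ (v.get x) (s τ x)) :
    Adeq σ (den M v) (M.subst s) := by
  have hext : ∀ {Γ : Ctx} {σ : Ty} {v : Env Γ} {s : ∀ τ : Ty, Var Γ τ → Term [] τ} {a : Vec σ}
      {N : Term [] σ}, (∀ τ (x : Var Γ τ), Adeq τ (v.get x) (s τ x)) → Adeq σ a N →
      ∀ τ (x : Var (σ :: Γ) τ), Adeq τ ((v.ext a).get x) (consSub s N τ x) := by
    intro Γ σ v s a N h hN τ x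
    cases x with
    | zero => exact hN
    | suc x => exact h _ x
  induction M with
  | num n => rw [den_num]; exact adeq_num n
  | coin p =>
    intro n
    rw [den_coin, iSup_numProb]
    simp only [Term.subst]
    rw [tsum_redMatrix_coin]
    exact add_le_add (mul_le_mul_right (adeq_num 0 n) _) (mul_le_mul_right (adeq_num 1 n) _)
  | var x => rw [den_var]; exact h _ x
  | succ M ih =>
    rw [den_succ_eq_wsum]
    exact Adeq.evalCtx isEvalCtx_succ (fun n => .of_dRed (.succ n) (adeq_num (n + 1))) (ih v s h)
  | ifz M P R ihM ihP ihR =>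
    rw [den_ifz]
    refine Adeq.evalCtx (isEvalCtx_ifz _ _) (fun n => ?_) (ihM v s h)
    cases n with
    | zero => exact .of_dRed (.ifzZero _ _) (ihP v s h)
    | succ n =>
      refine .of_dRed (.ifzSucc n _ _) ?_
      rw [Term.subst_liftSub_inst]
      -- The branch receives the predecessor `n`, both as a family and as a numeral.
      exact ihR _ _ (hext h (adeq_num n))
  | lam M ih =>
    intro a N hN
    rw [den_lam]
    refine .of_dRed (.beta _ _) ?_
    rw [Term.subst_liftSub_inst]
    exact ih _ _ (hext h hN)
  | app M N ihM ihN =>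
    rw [den_app]
    exact ihM v s h _ _ (ihN v s h)
  | fix M ih =>
    rw [den_fix]
    refine Adeq.iSup (iterate_ap_monotone _) fun n => ?_
    induction n with
    | zero => exact Adeq.zero
    | succ n ihn =>
      rw [Function.iterate_succ_apply']
      -- The next approximant is the denotation of `M` applied to the current one, hence adequate
      -- for the unfolding of the fixed point; adequacy then passes backwards along that reduction.
      exact .of_dRed (.fix _) (ih v s h _ _ ihn)

theorem natCoeff_le_iSup (M : Term [] Ty.nat) (n : ℕ) : M.natCoeff n ≤ ⨆ k, numProb k M n := by
  have h := adeq_den_subst M emptyEnv (fun _ x => .var x) fun τ x => nomatch x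
  rw [Term.subst_var] at h
  rw [← den_emptyEnv]
  exact h n

end PPCF

theorem mainTheorem3 (M : PPCF.Term [] PPCF.Ty.nat) (n : ℕ) :
    PPCF.matInfty (PPCF.redMatrix [] PPCF.Ty.nat) M (PPCF.Term.num n) = M.natCoeff n := by
  rw [PPCF.matInfty, if_pos (PPCF.redMatrix_num_self n)]
  exact le_antisymm (iSup_le fun k => PPCF.numProb_le_natCoeff k M n) (PPCF.natCoeff_le_iSup M n)
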